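/- All graphs are finite, simple and nonempty; $\lambda_{\min}(G)$ is the smallest eigenvalue of the adjacency matrix of $G$, and $d(x)$ is the degree of $x$. A graph is $\mu$-bounded with parameter $c$ if any two distinct non-adjacent vertices have at most $c$ common neighbours. A Hoffman graph $\mathfrak h$ is a graph whose vertices are labelled fat or slim, such that no two fat vertices are adjacent and every fat vertex has a slim neighbour. It is $t$-fat if every slim vertex has at least $t$ fat neighbours. An induced Hoffman subgraph is an induced subgraph with the inherited labels that is itself a Hoffman graph; isomorphisms preserve labels. Writing the adjacency matrix of $\mathfrak h$ as $\begin{pmatrix}A_{\rm slim}&D^T\\D&O\end{pmatrix}$, the special matrix of $\mathfrak h$ is $S(\mathfrak h)=A_{\rm slim}-D^TD$. We write $\mathfrak h=\uplus_{i=1}^r\mathfrak h_i$ if the slim vertices of $\mathfrak h$ can be partitioned into nonempty sets $V_1,\dots,V_r$ such that $S(\mathfrak h)$ is block diagonal with respect to this partition and $\mathfrak h_i$ is the Hoffman subgraph induced by $V_i$ together with all fat vertices that have a neighbour in $V_i$. For a family $\mathfrak G$ of Hoffman graphs, $\mathfrak h$ is a $\mathfrak G$-line Hoffman graph if there is a (finite)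 Hoffman graph $\mathfrak h'=\uplus_{i=1}^r\mathfrak h_i'$ that has $\mathfrak h$ as an induced Hoffman subgraph and has the same slim graph as $\mathfrak h$, where each $\mathfrak h_i'$ is isomorphic to an induced Hoffman subgraph of a member of $\mathfrak G$. For an integer $q\ge 2$, the associated Hoffman graph $\mathfrak g(G,q)$ has slim graph $G$ and one fat vertex for each maximal clique of $G$ with at least $q$ vertices, this fat vertex being adjacent precisely to the vertices of that clique. Let $\mathfrak h^{(3)}$ be the Hoffman graph with one slim vertex and three fat vertices adjacent to it, and let $\mathfrak k$ be the Hoffman graph with two adjacent slim vertices and two fat vertices, each fat vertex adjacent to both slim vertices. **Theorem.** Let $c$ be a positive integer, $\epsilon>0$ a real number, and $q\ge\max\{c+5,\,50\min\{c,6\}+16\}$ an integer. There exists a positive integer $K=K(\epsilon,c,q)$ (so $K$ depends only on $\epsilon$ and $c$ when $q=\max\{c+5,\,50\min\{c,6\}+16\}$) such that, if a graph $G$ satisfies 1. $G$ is $\mu$-bounded with parameter $c$, 2. every nonempty clique $C$ of $G$ has order at most $\min_{x\in C}d(x)-K$, 3. $\lambda_{\min}(G)\ge -2-\sqrt2+\epsilon$,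 then $\mathfrak g(G,q)$ is a $2$-fat $\{\mathfrak h^{(3)},\mathfrak k\}$-line Hoffman graph, and $\lambda_{\min}(G)\ge -3$. -/

import Mathlib

open Classical in
/-- The smallest eigenvalue of the adjacency matrix of a finite graph. -/
noncomputable def lambdaMin {V : Type*} [Fintype V] (G : SimpleGraph V) : ℝ :=
  sInf {θ : ℝ | Module.End.HasEigenvalue (Matrix.toLin' (G.adjMatrix ℝ)) θ}

/-- Distinct non-adjacent vertices have at most `c` common neighbours. -/
def IsMuBounded {V : Type*} (G : SimpleGraph V) (c : ℕ) : Prop :=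
  ∀ x y : V, x ≠ y → ¬ G.Adj x y → (G.commonNeighbors x y).ncard ≤ c

/-- The two labels of the vertices of a Hoffman graph. -/
inductive HoffmanLabel : Type
  | fat : HoffmanLabel
  | slim : HoffmanLabel

universe u

/-- A Hoffman graph: a graph with a labelling of the vertices as fat or slim, in which no two fat
vertices are adjacent and every fat vertex has a slim neighbour. -/
structure HoffmanGraph (V : Type u) where
  graph : SimpleGraph V
  label : V → HoffmanLabel
  not_adj_of_fat : ∀ f g : V, label f = HoffmanLabel.fat → label g = HoffmanLabel.fat →
    ¬ graph.Adj f g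
  exists_slim_adj : ∀ f : V, label f = HoffmanLabel.fat →
    ∃ x : V, label x = HoffmanLabel.slim ∧ graph.Adj f x

namespace HoffmanGraph

/-- The set of slim vertices. -/
def slimSet {V : Type u} (h : HoffmanGraph V) : Set V := {x | h.label x = HoffmanLabel.slim}

/-- The set of fat vertices. -/
def fatSet {V : Type u} (h : HoffmanGraph V) : Set V := {x | h.label x = HoffmanLabel.fat}

/-- `t`-fat: every slim vertex has at least `t` fat neighbours. -/
def IsFat {V : Type u} (h : HoffmanGraph V) (t : ℕ) : Prop :=
  ∀ x ∈ h.slimSet, t ≤ {f : V | f ∈ h.fatSet ∧ h.graph.Adj x f}.ncard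

/-- A label-preserving isomorphism of `h` onto an induced Hoffman subgraph of `k`. -/
structure InducedEmbedding {V W : Type*} (h : HoffmanGraph V) (k : HoffmanGraph W) where
  toEmbedding : h.graph ↪g k.graph
  label_eq : ∀ x : V, k.label (toEmbedding x) = h.label x

open Classical in
/-- The special matrix `A_slim - Dᵀ D`, where `D` is the fat-by-slim block of the adjacency
matrix. -/
noncomputable def specialMatrix {V : Type u} [Fintype V] (h : HoffmanGraph V) :
    Matrix h.slimSet h.slimSet ℝ :=
  let A : Matrix V V ℝ := h.graph.adjMatrix ℝ
  let D : Matrix h.fatSet h.slimSet ℝ := A.submatrix Subtype.val Subtype.val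
  A.submatrix Subtype.val Subtype.val - D.transpose * D

/-- The vertex set of the induced Hoffman subgraph generated by a set `P` of slim vertices: `P`
together with all fat vertices that have a neighbour in `P`. -/
def generatedSet {V : Type u} (h : HoffmanGraph V) (P : Set V) : Set V :=
  {x | (x ∈ P ∧ x ∈ h.slimSet) ∨ (x ∈ h.fatSet ∧ ∃ w ∈ P, w ∈ h.slimSet ∧ h.graph.Adj x w)}

/-- The induced Hoffman subgraph generated by the slim vertices in `P`. -/
def generated {V : Type u} (h : HoffmanGraph V) (P : Set V) :
    HoffmanGraph (h.generatedSet P) where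
  graph := h.graph.induce (h.generatedSet P)
  label := fun x => h.label x
  not_adj_of_fat := fun f g hf hg => h.not_adj_of_fat f g hf hg
  exists_slim_adj := by
    rintro ⟨f, hf⟩ hfat
    rcases hf with ⟨_, hs⟩ | ⟨_, w, hwP, hws, hadj⟩
    · have hs' : h.label f = HoffmanLabel.slim := hs
      have hfat' : h.label f = HoffmanLabel.fat := hfat
      rw [hs'] at hfat'
      cases hfat'
    · exact ⟨⟨w, Or.inl ⟨hwP, hws⟩⟩, hws, hadj⟩

/-- The sets `P 0, …, P (r-1)` form a partition of the set of slim vertices of `h` with respect to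
which the special matrix of `h` is block diagonal. The corresponding decomposition of `h` is the
family of the Hoffman graphs `h.generated (P i)`. (A generated subgraph contains all fat
neighbours of its slim vertices, so its special matrix is the diagonal block of `specialMatrix h`
belonging to `P i`; see `specialMatrix_generated`.) -/
structure IsDecomposition {V : Type u} [Fintype V] (h : HoffmanGraph V) {r : ℕ}
    (P : Fin r → Set V) : Prop where
  nonempty : ∀ i, (P i).Nonempty
  pairwise_disjoint : ∀ i j, i ≠ j → Disjoint (P i) (P j)
  union_eq : (⋃ i, P i) = h.slimSet
  block_diagonal : ∀ i j, i ≠ j → ∀ x y : h.slimSet, (x : V) ∈ P i → (y : V) ∈ P j →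
    h.specialMatrix x y = 0

open Classical in
/-- The special matrix of a generated subgraph is a principal submatrix of the special matrix. -/
theorem specialMatrix_generated {V : Type u} [Fintype V] (h : HoffmanGraph V) (P : Set V)
    (x y : (h.generated P).slimSet) :
    (h.generated P).specialMatrix x y =
      h.specialMatrix ⟨x.1.1, x.2⟩ ⟨y.1.1, y.2⟩ := by
  have hx : (x.1 : V) ∈ P ∧ (x.1 : V) ∈ h.slimSet := by
    have hs : h.label x.1.1 = HoffmanLabel.slim := x.2
    rcases x.1.2 with h1 | ⟨h1, _⟩
    · exact h1
    · have h1' : h.label x.1.1 = HoffmanLabel.fat := h1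
      rw [hs] at h1'
      cases h1'
  simp only [specialMatrix, Matrix.sub_apply, Matrix.submatrix_apply, Matrix.mul_apply,
    Matrix.transpose_apply, SimpleGraph.adjMatrix_apply]
  congr 1
  refine Finset.sum_of_injOn
    (fun f : (h.generated P).fatSet => (⟨f.1.1, f.2⟩ : h.fatSet)) ?_ ?_ ?_ ?_
  · intro a _ b _ hab
    have hab' : (a.1.1 : V) = b.1.1 := congrArg (fun f : h.fatSet => (f : V)) hab
    exact Subtype.ext (Subtype.ext hab')
  · intro a _
    simp
  · intro f _ hf
    have hna : ¬ h.graph.Adj f.1 x.1.1 := by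
      intro hadj
      apply hf
      refine ⟨⟨⟨f.1, Or.inr ⟨f.2, x.1.1, hx.1, hx.2, hadj⟩⟩, f.2⟩, by simp, rfl⟩
    simp [hna]
  · intro f _
    rfl

/-- A `𝔊`-line Hoffman graph: `h` is an induced Hoffman subgraph, containing all slim vertices, of
a finite Hoffman graph `h'` that has a decomposition each member of which is isomorphic to an
induced Hoffman subgraph of a member of the family `𝔊`. -/
def IsLine {V : Type u} (𝔊 : Set (Σ U : Type, HoffmanGraph U)) (h : HoffmanGraph V) : Prop :=
  ∃ (W : Type u) (_ : Fintype W) (h' : HoffmanGraph W),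
    (∃ e : InducedEmbedding h h', ∀ w ∈ h'.slimSet, ∃ v ∈ h.slimSet, e.toEmbedding v = w) ∧
    ∃ (r : ℕ) (P : Fin r → Set W), h'.IsDecomposition P ∧
      ∀ i, ∃ k ∈ 𝔊, Nonempty (InducedEmbedding (h'.generated (P i)) k.2)

/-- The Hoffman graph with `s` pairwise adjacent slim vertices (the left summand) and `t` fat
vertices (the right summand), in which every slim vertex is adjacent to every fat vertex. -/
def completeHoffman (s t : ℕ) (hs : 0 < s) : HoffmanGraph (Fin s ⊕ Fin t) where
  graph :=
    { Adj := fun x y => x ≠ y ∧ ¬ (x.isRight ∧ y.isRight)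
      symm := ⟨fun _ _ hxy => ⟨hxy.1.symm, fun hc => hxy.2 hc.symm⟩⟩
      loopless := ⟨fun _ hx => hx.1 rfl⟩ }
  label := Sum.elim (fun _ => HoffmanLabel.slim) (fun _ => HoffmanLabel.fat)
  not_adj_of_fat := by
    rintro (f | f) (g | g) hf hg hadj
    · cases hf
    · cases hf
    · cases hg
    · exact hadj.2 ⟨rfl, rfl⟩
  exists_slim_adj := by
    rintro (f | f) hf
    · cases hf
    · exact ⟨Sum.inl ⟨0, hs⟩, rfl, by simp, by simp⟩

/-- The family consisting of `𝔥⁽³⁾` (one slim vertex with three fat neighbours) and the Hoffman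
graph with two adjacent slim vertices, both adjacent to the same two fat vertices. -/
def lineFamily : Set (Σ U : Type, HoffmanGraph U) :=
  {⟨Fin 1 ⊕ Fin 3, completeHoffman 1 3 (by decide)⟩,
    ⟨Fin 2 ⊕ Fin 2, completeHoffman 2 2 (by decide)⟩}

end HoffmanGraph

/-- The associated Hoffman graph `𝔤(G,q)`: its slim graph is `G`, its fat vertices are the maximal
cliques of `G` with at least `q` vertices, and each of them is adjacent to its own elements. -/
def associatedHoffman {V : Type u} (G : SimpleGraph V) (q : ℕ) (hq : 2 ≤ q) :
    HoffmanGraph (V ⊕ {C : Set V // Maximal G.IsClique C ∧ q ≤ C.ncard}) where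
  graph :=
    { Adj := fun a b =>
        match a, b with
        | Sum.inl x, Sum.inl y => G.Adj x y
        | Sum.inl x, Sum.inr C => x ∈ C.1
        | Sum.inr C, Sum.inl x => x ∈ C.1
        | Sum.inr _, Sum.inr _ => False
      symm := ⟨by
        rintro (x | C) (y | D) hxy
        · exact SimpleGraph.Adj.symm hxy
        · exact hxy
        · exact hxy
        · exact hxy⟩
      loopless := ⟨by
        rintro (x | C) hx
        · exact G.irrefl hx
        · exact hx⟩ }
  label := Sum.elim (fun _ => HoffmanLabel.slim) (fun _ => HoffmanLabel.fat)
  not_adj_of_fat := by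
    rintro (f | f) (g | g) hf hg hadj
    · cases hf
    · cases hf
    · cases hg
    · exact hadj
  exists_slim_adj := by
    rintro (f | ⟨C, hC, hqC⟩) hf
    · cases hf
    · have hne : C.Nonempty := Set.nonempty_of_ncard_ne_zero (by omega)
      obtain ⟨x, hx⟩ := hne
      exact ⟨Sum.inl x, rfl, hx⟩

/-! Fix a size `M`, large in terms of `c`, `ε` and `q`, and call a maximal clique large if it has at
least `M` vertices. A Ramsey argument turns the degree condition into two large cliques through
every vertex: stars with sixteen leaves are excluded by the eigenvalue bound, so many neighbours
outside a clique contain another big clique.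

By μ-boundedness, the normalized indicators of the large cliques are almost orthonormal for the form
of `A + θI`, and pairing with them almost sums a vector over the clique. An approximate Bessel
inequality (`sum_sq_sum_le_shiftedForm`) then says that, on vectors with small support, the form
dominates the sum of the squared clique sums up to a small error. Equivalently, small principal
submatrices of the special matrix `S`, with the large cliques as fat vertices, have no eigenvalue
noticeably below `-θ`, where `θ < 2 + √2`.

Test vectors on at most three vertices yield `IsCliqueLocal`: diagonal entries of `S` are -2 or -3,
a row with diagonal -3 vanishes elsewhere, other off-diagonal entries are 0 or ±1, and two nonzero
entries in a row force a triangle of nonzero entries with product 1. Hence an entry -1 is isolated,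
joining two vertices with the same two large cliques, while the entries 1 form disjoint cliques
(`plusClass`).

One further fat vertex on each nontrivial plus class cancels all entries 1 (`lineCliques`). The new
special matrix is block diagonal, with blocks of order 1 (entry -2 or -3) or of order 2 (diagonal
-2, off-diagonal -1), all with eigenvalues at least -3. This gives both `-3 ≤ lambdaMin G` and the
decomposition into subgraphs of the two members of `lineFamily`. Finally, a maximal clique with more
than 42 but fewer than `M` vertices is a plus class (`eq_plusClass`), so every fat vertex of the
associated Hoffman graph occurs in the extended one. -/

/-! ### Ramsey's theorem -/

open Finset in
/-- Ramsey's theorem for graphs, relative to a set of vertices. -/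
theorem exists_isClique_or_isIndepSet (s t : ℕ) : ∃ N : ℕ, ∀ (V : Type u) (G : SimpleGraph V)
    (R : Finset V), N ≤ #R →
      (∃ S ⊆ R, #S = s ∧ G.IsClique (S : Set V)) ∨ (∃ T ⊆ R, #T = t ∧ G.IsIndepSet (T : Set V)) := by
  classical
  induction s generalizing t with
  | zero => exact ⟨0, fun V G R _ => Or.inl ⟨∅, by simp⟩⟩
  | succ s ihs =>
    induction t with
    | zero => exact ⟨0, fun V G R _ => Or.inr ⟨∅, by simp [SimpleGraph.IsIndepSet]⟩⟩
    | succ t iht =>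
      obtain ⟨N₁, h₁⟩ := ihs (t + 1)
      obtain ⟨N₂, h₂⟩ := iht
      -- Apart from a chosen vertex `x`, there are at least `N₁` neighbours or at least `N₂`
      -- non-neighbours of `x`.
      refine ⟨N₁ + N₂ + 1, fun V G R hR => ?_⟩
      obtain ⟨x, hx⟩ : R.Nonempty := card_pos.1 (by omega)
      have hsum := card_filter_add_card_filter_not (s := R.erase x) (fun y => G.Adj x y)
      rw [card_erase_of_mem hx] at hsum
      have hsub : ∀ (p : V → Prop) [DecidablePred p], (R.erase x).filter p ⊆ R :=
        fun p _ => (filter_subset _ _).trans (erase_subset _ _)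
      by_cases h : N₁ ≤ #((R.erase x).filter (fun y => G.Adj x y))
      · rcases h₁ V G _ h with ⟨S, hS, hc, hq⟩ | ⟨T, hT, hc, hq⟩
        · have hxS : x ∉ S := fun hxS => by simpa using hS hxS
          refine Or.inl ⟨insert x S, insert_subset hx (hS.trans (hsub _)), by simp [hxS, hc], ?_⟩
          rw [coe_insert, SimpleGraph.isClique_insert]
          exact ⟨hq, fun b hb _ => (mem_filter.1 (hS hb)).2⟩
        · exact Or.inr ⟨T, hT.trans (hsub _), hc, hq⟩
      · rcases h₂ V G ((R.erase x).filter (fun y => ¬ G.Adj x y)) (by omega) with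
          ⟨S, hS, hc, hq⟩ | ⟨T, hT, hc, hq⟩
        · exact Or.inl ⟨S, hS.trans (hsub _), hc, hq⟩
        · have hxT : x ∉ T := fun hxT => by simpa using hT hxT
          refine Or.inr ⟨insert x T, insert_subset hx (hT.trans (hsub _)), by simp [hxT, hc], ?_⟩
          rw [coe_insert, SimpleGraph.IsIndepSet, Set.pairwise_insert]
          refine ⟨hq, fun b hb _ => ?_⟩
          have := (mem_filter.1 (hT hb)).2
          exact ⟨this, fun h => this h.symm⟩

/-! ### The form of `A + θI`, the smallest eigenvalue and diagonal dominance -/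

/-- The symmetric bilinear form `u ↦ uᵀ (A + θ I) w` of a graph. -/
noncomputable def shiftedForm {V : Type*} [Fintype V] [DecidableEq V] (G : SimpleGraph V)
    [DecidableRel G.Adj] (θ : ℝ) : LinearMap.BilinForm ℝ (V → ℝ) :=
  Matrix.toBilin' (G.adjMatrix ℝ + θ • (1 : Matrix V V ℝ))

section
variable {V : Type*} [Fintype V] [DecidableEq V] (G : SimpleGraph V) [DecidableRel G.Adj] (θ : ℝ)

theorem shiftedForm_apply (u w : V → ℝ) : shiftedForm G θ u w =
    ∑ x, ∑ y, u x * ((if G.Adj x y then 1 else 0) + if x = y then θ else 0) * w y := by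
  simp only [shiftedForm, Matrix.toBilin'_apply, Matrix.one_apply, SimpleGraph.adjMatrix_apply,
    Matrix.add_apply, Matrix.smul_apply, smul_eq_mul, mul_ite, mul_one, mul_zero]

theorem shiftedForm_eq_dotProduct (u w : V → ℝ) : shiftedForm G θ u w =
    u ⬝ᵥ ((G.adjMatrix ℝ).mulVec w) + θ * (u ⬝ᵥ w) := by
  simp [shiftedForm, Matrix.toBilin'_apply']

theorem shiftedForm_comm (u w : V → ℝ) : shiftedForm G θ u w = shiftedForm G θ w u := by
  rw [shiftedForm_apply, shiftedForm_apply, Finset.sum_comm]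
  refine Finset.sum_congr rfl fun x _ => Finset.sum_congr rfl fun y _ => ?_
  simp only [G.adj_comm x y, eq_comm (a := x)]
  ring

omit [Fintype V] in
theorem isHermitian_adjMatrix_add_smul_one :
    (G.adjMatrix ℝ + θ • (1 : Matrix V V ℝ)).IsHermitian := by
  apply Matrix.IsHermitian.ext
  intro i j
  simp [Matrix.one_apply, SimpleGraph.adjMatrix_apply, G.adj_comm i j, eq_comm (a := i)]

theorem shiftedForm_nonneg_of_neg_le_lambdaMin (h : -θ ≤ lambdaMin G) (u : V → ℝ) :
    0 ≤ shiftedForm G θ u u := by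
  have hpos : (G.adjMatrix ℝ + θ • (1 : Matrix V V ℝ)).PosSemidef := by
    have hH := isHermitian_adjMatrix_add_smul_one G θ
    rw [hH.posSemidef_iff_eigenvalues_nonneg]
    intro i
    have hi := hH.mulVec_eigenvectorBasis i
    have hev : Module.End.HasEigenvalue (Matrix.toLin' (G.adjMatrix ℝ)) (hH.eigenvalues i - θ) := by
      apply Module.End.hasEigenvalue_of_hasEigenvector
        (x := WithLp.ofLp (hH.eigenvectorBasis i))
      rw [Module.End.hasEigenvector_iff, Module.End.mem_eigenspace_iff]
      constructor
      · rw [Matrix.add_mulVec, Matrix.smul_mulVec, Matrix.one_mulVec] at hi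
        rw [Matrix.toLin'_apply, sub_smul, ← hi]
        simp
      · intro h0
        exact hH.eigenvectorBasis.toBasis.ne_zero i (by simpa using h0)
    have hfin : {t : ℝ | Module.End.HasEigenvalue (Matrix.toLin' (G.adjMatrix ℝ)) t}.Finite :=
      Module.End.finite_hasEigenvalue _
    have hle : lambdaMin G ≤ hH.eigenvalues i - θ := by
      refine csInf_le ?_ ?_
      · convert hfin.bddBelow
      · convert hev
    show (0 : ℝ) ≤ _
    linarith
  have := hpos.dotProduct_mulVec_nonneg u
  rw [shiftedForm, Matrix.toBilin'_apply']
  exact this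

theorem neg_le_lambdaMin_of_shiftedForm_nonneg [Nonempty V]
    (h : ∀ u : V → ℝ, 0 ≤ shiftedForm G θ u u) : -θ ≤ lambdaMin G := by
  have hH := isHermitian_adjMatrix_add_smul_one G θ
  have key : ∀ t : ℝ, Module.End.HasEigenvalue (Matrix.toLin' (G.adjMatrix ℝ)) t → -θ ≤ t := by
    intro t ht
    obtain ⟨v, hv⟩ := ht.exists_hasEigenvector
    have h1 := hv.apply_eq_smul
    rw [Matrix.toLin'_apply] at h1
    have h2 := h v
    rw [shiftedForm_eq_dotProduct, h1, dotProduct_smul, smul_eq_mul] at h2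
    have h3 : 0 < v ⬝ᵥ v := by
      have := Matrix.dotProduct_star_self_pos_iff.2 hv.2
      simpa using this
    by_contra hlt
    push Not at hlt
    nlinarith
  unfold lambdaMin
  refine le_csInf ?_ fun t ht => key t (by convert ht)
  have hA : (G.adjMatrix ℝ).IsHermitian := by
    simp
  obtain ⟨i⟩ := ‹Nonempty V›
  refine ⟨hA.eigenvalues i, ?_⟩
  have hev : Module.End.HasEigenvalue (Matrix.toLin' (G.adjMatrix ℝ)) (hA.eigenvalues i) := by
    apply Module.End.hasEigenvalue_of_hasEigenvector
      (x := WithLp.ofLp (hA.eigenvectorBasis i))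
    rw [Module.End.hasEigenvector_iff, Module.End.mem_eigenspace_iff]
    refine ⟨hA.mulVec_eigenvectorBasis i, fun h0 => ?_⟩
    exact hA.eigenvectorBasis.toBasis.ne_zero i (by simpa using h0)
  show Module.End.HasEigenvalue _ _
  convert hev
end

/-- A symmetric diagonally dominant matrix is positive semidefinite. -/
theorem sum_sum_mul_mul_nonneg_of_diagonally_dominant {V : Type*} [Fintype V] [DecidableEq V]
    (T : V → V → ℝ) (hT : ∀ x y, T x y = T y x)
    (hdom : ∀ x, ∑ y ∈ Finset.univ.erase x, |T x y| ≤ T x x) (u : V → ℝ) :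
    0 ≤ ∑ x, ∑ y, u x * T x y * u y := by
  have h1 : ∀ x y, -(|T x y| * u x ^ 2 + |T x y| * u y ^ 2) / 2 ≤ u x * T x y * u y := by
    intro x y
    rcases abs_cases (T x y) with ⟨h, h'⟩ | ⟨h, h'⟩ <;> rw [h]
    · nlinarith [mul_nonneg h' (sq_nonneg (u x + u y))]
    · nlinarith [mul_nonneg (by linarith : 0 ≤ - T x y) (sq_nonneg (u x - u y))]
  have h2 : ∀ x, u x ^ 2 * T x x - ∑ y ∈ Finset.univ.erase x,
      (|T x y| * u x ^ 2 + |T x y| * u y ^ 2) / 2 ≤ ∑ y, u x * T x y * u y := by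
    intro x
    rw [← Finset.add_sum_erase _ _ (Finset.mem_univ x), sub_eq_add_neg, ← Finset.sum_neg_distrib]
    refine add_le_add (by ring_nf; rfl) (Finset.sum_le_sum fun y _ => ?_)
    have := h1 x y
    linarith
  refine le_trans ?_ (Finset.sum_le_sum fun x _ => h2 x)
  have h3 : ∑ x, ∑ y ∈ Finset.univ.erase x, |T x y| * u y ^ 2 =
      ∑ x, ∑ y ∈ Finset.univ.erase x, |T x y| * u x ^ 2 := by
    rw [Finset.sum_comm' (t' := Finset.univ) (s' := fun y => Finset.univ.erase y)
      (by intro x y; simp [eq_comm])]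
    simp only [hT]
  have h4 : ∑ x, ∑ y ∈ Finset.univ.erase x, (|T x y| * u x ^ 2 + |T x y| * u y ^ 2) / 2 =
      ∑ x, ∑ y ∈ Finset.univ.erase x, |T x y| * u x ^ 2 := by
    simp only [← Finset.sum_div, Finset.sum_add_distrib]
    rw [h3]; ring
  rw [Finset.sum_sub_distrib, h4, ← Finset.sum_sub_distrib]
  refine Finset.sum_nonneg fun x _ => ?_
  rw [← Finset.sum_mul]
  nlinarith [mul_nonneg (sub_nonneg.2 (hdom x)) (sq_nonneg (u x))]

/-! ### Large maximal cliques as an almost orthonormal system -/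

open Finset in
/-- If the vectors `w i` are almost orthonormal and have inner products close to `a i` with `p`,
then Bessel's inequality almost holds for the numbers `a i`. -/
theorem sum_sq_le_of_almost_orthonormal {E ι : Type*} [AddCommGroup E] [Module ℝ E] [DecidableEq ι]
    (B : LinearMap.BilinForm ℝ E) (hsymm : ∀ u w, B u w = B w u) (hpos : ∀ u, 0 ≤ B u u)
    (s : Finset ι) (w : ι → E) (p : E) (a : ι → ℝ) (δ L : ℝ)
    (ha : ∀ i ∈ s, |a i| ≤ L) (h1 : ∀ i ∈ s, |B p (w i) - a i| ≤ δ * L)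
    (h2 : ∀ i ∈ s, ∀ j ∈ s, |B (w i) (w j) - if i = j then 1 else 0| ≤ δ) :
    ∑ i ∈ s, a i ^ 2 ≤ B p p + δ * L ^ 2 * (2 * #s + #s ^ 2) := by
  -- As in Bessel's inequality, the form is evaluated at `p` minus its approximate projection; the
  -- cross terms cost `2 * #s` errors and the double sum `#s ^ 2`.
  have hexp : B (p - ∑ i ∈ s, a i • w i) (p - ∑ i ∈ s, a i • w i) =
      B p p - 2 * ∑ i ∈ s, a i * B p (w i) + ∑ i ∈ s, ∑ j ∈ s, a i * a j * B (w i) (w j) := by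
    have e1 : B p (∑ i ∈ s, a i • w i) = ∑ i ∈ s, a i * B p (w i) := by simp
    have e2 : B (∑ i ∈ s, a i • w i) (∑ i ∈ s, a i • w i) =
        ∑ i ∈ s, ∑ j ∈ s, a i * a j * B (w i) (w j) := by
      simp only [map_sum, map_smul, LinearMap.sum_apply, LinearMap.smul_apply, smul_eq_mul]
      rw [sum_comm]
      refine sum_congr rfl fun i _ => ?_
      rw [mul_sum]
      exact sum_congr rfl fun j _ => by ring
    have e3 := hsymm (∑ i ∈ s, a i • w i) p
    rw [LinearMap.BilinForm.sub_left, LinearMap.BilinForm.sub_right,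
      LinearMap.BilinForm.sub_right, e2, e3, e1]
    ring
  have hu := hpos (p - ∑ i ∈ s, a i • w i)
  rw [hexp] at hu
  have hA : ∑ i ∈ s, a i ^ 2 - #s * (δ * L ^ 2) ≤ ∑ i ∈ s, a i * B p (w i) := by
    rw [← nsmul_eq_mul, ← sum_const, ← sum_sub_distrib]
    refine sum_le_sum fun i hi => ?_
    have h3 : |a i * (B p (w i) - a i)| ≤ L * (δ * L) := by
      rw [abs_mul]
      exact mul_le_mul (ha i hi) (h1 i hi) (abs_nonneg _) ((abs_nonneg _).trans (ha i hi))
    have := (abs_le.1 h3).1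
    nlinarith
  have hB : ∑ i ∈ s, ∑ j ∈ s, a i * a j * B (w i) (w j) ≤
      ∑ i ∈ s, a i ^ 2 + #s * (#s * (δ * L ^ 2)) := by
    rw [← nsmul_eq_mul, ← sum_const, ← sum_add_distrib]
    refine sum_le_sum fun i hi => ?_
    have h0 : a i ^ 2 = ∑ j ∈ s, a i * a j * (if i = j then 1 else 0) := by
      simp [hi, sq]
    rw [h0, ← nsmul_eq_mul, ← sum_const, ← sum_add_distrib]
    refine sum_le_sum fun j hj => ?_
    have h3 : |a i * a j * (B (w i) (w j) - if i = j then 1 else 0)| ≤ L * L * δ := by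
      rw [abs_mul, abs_mul]
      have hL := (abs_nonneg _).trans (ha i hi)
      exact mul_le_mul (mul_le_mul (ha i hi) (ha j hj) (abs_nonneg _) hL) (h2 i hi j hj)
        (abs_nonneg _) (mul_nonneg hL hL)
    have := (abs_le.1 h3).2
    nlinarith
  nlinarith

open Finset in
/-- A vertex outside a maximal clique has at most `c` neighbours in it. -/
theorem IsMuBounded.card_filter_adj_le {V : Type*} [DecidableEq V] [Fintype V] {G : SimpleGraph V}
    [DecidableRel G.Adj] {c : ℕ} (hG : IsMuBounded G c) {F : Finset V}
    (hF : Maximal G.IsClique (F : Set V)) {x : V} (hx : x ∉ F) : #{y ∈ F | G.Adj x y} ≤ c := by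
  obtain ⟨z, hz, hxz, hne⟩ : ∃ z ∈ F, ¬ G.Adj x z ∧ x ≠ z := by
    by_contra! hcon
    apply hx
    have hcl : G.IsClique ((insert x F : Finset V) : Set V) := by
      rw [coe_insert, SimpleGraph.isClique_insert]
      refine ⟨hF.prop, fun b hb hne => ?_⟩
      by_contra hadj
      exact hne (hcon b hb hadj)
    have := hF.le_of_ge hcl (by simp)
    exact this (by simp)
  refine le_trans ?_ (hG x z hne hxz)
  rw [← Set.ncard_coe_finset]
  refine Set.ncard_le_ncard (fun y hy => ?_) (Set.toFinite _)
  simp only [coe_filter, Set.mem_ofPred_eq] at hy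
  rw [SimpleGraph.mem_commonNeighbors]
  exact ⟨hy.2, hF.prop hz hy.1 (by rintro rfl; exact hxz hy.2)⟩

theorem exists_mem_notMem_of_maximal_isClique {V : Type*} {G : SimpleGraph V} {F F' : Finset V}
    (hF : Maximal G.IsClique (F : Set V)) (hF' : Maximal G.IsClique (F' : Set V)) (hne : F ≠ F') :
    ∃ x ∈ F', x ∉ F := by
  by_contra! hcon
  have h1 : (F' : Set V) ⊆ F := fun x hx => hcon x hx
  exact hne (Finset.coe_injective (h1.antisymm (hF'.le_of_ge hF.prop h1)).symm)

open Finset in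
-- A vertex of `F'` outside `F` is adjacent to the whole intersection.
theorem IsMuBounded.card_inter_le {V : Type*} [DecidableEq V] [Fintype V] {G : SimpleGraph V}
    {c : ℕ} (hG : IsMuBounded G c) {F F' : Finset V} (hF : Maximal G.IsClique (F : Set V))
    (hF' : Maximal G.IsClique (F' : Set V)) (hne : F ≠ F') : #(F ∩ F') ≤ c := by
  classical
  obtain ⟨x, hx, hxF⟩ := exists_mem_notMem_of_maximal_isClique hF hF' hne
  refine le_trans (card_le_card fun y hy => ?_) (hG.card_filter_adj_le hF hxF)
  rw [mem_inter] at hy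
  exact mem_filter.2 ⟨hy.1, hF'.prop hx hy.2 (by rintro rfl; exact hxF hy.1)⟩

/-- The characteristic vector of a finite set, normalized to have entries with sum `1`. -/
noncomputable def uniformVector {V : Type*} [DecidableEq V] (F : Finset V) : V → ℝ :=
  fun x => if x ∈ F then (F.card : ℝ)⁻¹ else 0

section
open Finset
variable {V : Type*} [Fintype V] [DecidableEq V] {G : SimpleGraph V} [DecidableRel G.Adj]
  {c M : ℕ} {θ : ℝ}

/-- `A + θI` almost maps the normalized indicator of `F` to the plain indicator: a row in `F` gives
`(#F - 1 + θ) / #F`, and a row outside gives at most `c / #F`. -/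
theorem abs_sum_mul_uniformVector_sub_le (hG : IsMuBounded G c) (hM : 0 < M) (hθ : 1 ≤ θ)
    {F : Finset V} (hF : Maximal G.IsClique (F : Set V)) (hMF : M ≤ #F) (x : V) :
    |∑ y, ((if G.Adj x y then 1 else 0) + if x = y then θ else 0) * uniformVector F y -
      if x ∈ F then 1 else 0| ≤ (c + θ) / M := by
  have hFpos : (0 : ℝ) < #F := by exact_mod_cast hM.trans_le hMF
  have hMpos : (0 : ℝ) < M := by exact_mod_cast hM
  have hr : ∑ y, ((if G.Adj x y then 1 else 0) + if x = y then θ else 0) * uniformVector F y =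
      (#{y ∈ F | G.Adj x y} + if x ∈ F then θ else 0) / #F := by
    simp only [uniformVector, mul_ite, mul_zero, ← sum_filter]
    rw [filter_mem_eq_inter, univ_inter, ← sum_mul, sum_add_distrib, div_eq_mul_inv]
    simp
  have hle : (c + θ) / (#F : ℝ) ≤ (c + θ) / M :=
    div_le_div_of_nonneg_left (by positivity) hMpos (by exact_mod_cast hMF)
  refine le_trans ?_ hle
  rw [hr]
  have hc0 : (0 : ℝ) ≤ c := by positivity
  by_cases hx : x ∈ F
  · have h1 : ({y ∈ F | G.Adj x y} : Finset V) = F.erase x := by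
      ext y
      rw [mem_filter, mem_erase]
      exact ⟨fun h => ⟨h.2.ne', h.1⟩, fun h => ⟨h.2, hF.prop hx h.2 h.1.symm⟩⟩
    rw [h1, card_erase_of_mem hx, Nat.cast_sub (by exact_mod_cast hM.trans_le hMF), if_pos hx,
      if_pos hx]
    have h2 : ((#F : ℝ) - (1 : ℕ) + θ) / #F - 1 = (θ - 1) / #F := by
      field_simp
      push_cast
      ring
    rw [h2, abs_of_nonneg (div_nonneg (by linarith) hFpos.le)]
    exact div_le_div_of_nonneg_right (by linarith) hFpos.le
  · rw [if_neg hx, if_neg hx, sub_zero, add_zero, abs_of_nonneg (by positivity)]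
    have : (#{y ∈ F | G.Adj x y} : ℝ) ≤ c := by exact_mod_cast hG.card_filter_adj_le hF hx
    exact div_le_div_of_nonneg_right (by linarith) hFpos.le

theorem abs_shiftedForm_uniformVector_sub_le (hG : IsMuBounded G c) (hM : 0 < M) (hθ : 1 ≤ θ)
    {F : Finset V} (hF : Maximal G.IsClique (F : Set V)) (hMF : M ≤ #F) (p : V → ℝ) :
    |shiftedForm G θ p (uniformVector F) - ∑ x ∈ F, p x| ≤ (c + θ) / M * ∑ x, |p x| := by
  have h1 : shiftedForm G θ p (uniformVector F) - ∑ x ∈ F, p x = ∑ x, p x *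
      (∑ y, ((if G.Adj x y then 1 else 0) + if x = y then θ else 0) * uniformVector F y -
        if x ∈ F then 1 else 0) := by
    simp only [mul_sub, sum_sub_distrib, mul_ite, mul_one, mul_zero, ← sum_filter,
      filter_mem_eq_inter, univ_inter]
    rw [shiftedForm_apply]
    simp only [mul_assoc, mul_sum]
  rw [h1, mul_sum]
  refine (abs_sum_le_sum_abs _ _).trans (sum_le_sum fun x _ => ?_)
  rw [abs_mul, mul_comm]
  exact mul_le_mul_of_nonneg_right (abs_sum_mul_uniformVector_sub_le hG hM hθ hF hMF x)
    (abs_nonneg _)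

theorem sum_abs_uniformVector {F : Finset V} (hF : F.Nonempty) : ∑ x, |uniformVector F x| = 1 := by
  have : (#F : ℝ) ≠ 0 := by exact_mod_cast hF.card_pos.ne'
  simp only [uniformVector, apply_ite abs, abs_zero, ← sum_filter, filter_mem_eq_inter, univ_inter]
  simp [this]

theorem abs_shiftedForm_uniformVector_uniformVector_sub_le (hG : IsMuBounded G c) (hM : 0 < M)
    (hθ : 1 ≤ θ) {F F' : Finset V} (hF : Maximal G.IsClique (F : Set V)) (hMF : M ≤ #F)
    (hF' : Maximal G.IsClique (F' : Set V)) (hMF' : M ≤ #F') :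
    |shiftedForm G θ (uniformVector F) (uniformVector F') - if F = F' then 1 else 0| ≤
      (2 * c + θ) / M := by
  have hFpos : (0 : ℝ) < #F := by exact_mod_cast hM.trans_le hMF
  have hMpos : (0 : ℝ) < M := by exact_mod_cast hM
  have h1 := abs_shiftedForm_uniformVector_sub_le hG hM hθ hF' hMF' (uniformVector F)
  rw [sum_abs_uniformVector (card_pos.1 (hM.trans_le hMF)), mul_one] at h1
  have h2 : ∑ x ∈ F', uniformVector F x = #(F ∩ F') / #F := by
    simp only [uniformVector, ← sum_filter, filter_mem_eq_inter]
    rw [inter_comm]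
    simp [div_eq_mul_inv]
  rw [h2] at h1
  have h3 : |(#(F ∩ F') : ℝ) / #F - if F = F' then 1 else 0| ≤ c / M := by
    split_ifs with h
    · subst h
      rw [inter_self, div_self hFpos.ne', sub_self, abs_zero]
      positivity
    · rw [sub_zero, abs_of_nonneg (by positivity)]
      exact div_le_div₀ (by positivity) (by exact_mod_cast hG.card_inter_le hF hF' h) hMpos
        (by exact_mod_cast hMF)
  have h4 : (2 * c + θ) / M = (c + θ) / M + c / (M : ℝ) := by ring
  rw [h4]
  refine le_trans ?_ (add_le_add h1 h3)
  refine le_trans (le_of_eq ?_) (abs_add_le _ _)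
  congr 1
  ring

/-- If the smallest eigenvalue is at least `-θ`, then the form `p ↦ pᵀ (A + θ I) p` is at least the
sum of the squares of the sums of `p` over large maximal cliques, up to a small error. -/
theorem sum_sq_sum_le_shiftedForm (hG : IsMuBounded G c) (hM : 0 < M) (hθ : 1 ≤ θ)
    (hlam : -θ ≤ lambdaMin G) (s : Finset (Finset V))
    (hs : ∀ F ∈ s, Maximal G.IsClique (F : Set V) ∧ M ≤ #F) (hcard : #s ≤ 9)
    (p : V → ℝ) (hp : ∑ x, |p x| ≤ 5) :
    ∑ F ∈ s, (∑ x ∈ F, p x) ^ 2 ≤ shiftedForm G θ p p + (2 * c + θ) / M * 2475 := by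
  have hMpos : (0 : ℝ) < M := by exact_mod_cast hM
  have hδ : (0 : ℝ) ≤ (2 * c + θ) / M := by positivity
  have h := sum_sq_le_of_almost_orthonormal (shiftedForm G θ) (shiftedForm_comm G θ)
    (shiftedForm_nonneg_of_neg_le_lambdaMin G θ hlam) s uniformVector p (fun F => ∑ x ∈ F, p x)
    ((2 * c + θ) / M) 5
    (fun F _ => (abs_sum_le_sum_abs _ _).trans ((sum_le_sum_of_subset_of_nonneg (subset_univ _)
      fun _ _ _ => abs_nonneg _).trans hp))
    (fun F hF => (abs_shiftedForm_uniformVector_sub_le hG hM hθ (hs F hF).1 (hs F hF).2 p).trans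
      (mul_le_mul (div_le_div_of_nonneg_right (by linarith [(Nat.cast_nonneg c : (0 : ℝ) ≤ c)])
        hMpos.le) hp (sum_nonneg fun _ _ => abs_nonneg _) hδ))
    (fun F hF F' hF' => abs_shiftedForm_uniformVector_uniformVector_sub_le hG hM hθ
      (hs F hF).1 (hs F hF).2 (hs F' hF').1 (hs F' hF').2)
  refine h.trans (add_le_add le_rfl ?_)
  -- The constant is `5² * (2 * 9 + 9²) = 2475`; nine cliques suffice for three vertices with three
  -- cliques each.
  rw [mul_assoc]
  refine mul_le_mul_of_nonneg_left ?_ hδ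
  have h9 : (#s : ℝ) ≤ 9 := by exact_mod_cast hcard
  have h0 : (0 : ℝ) ≤ #s := by positivity
  nlinarith
end

/-! ### Local conditions from test vectors -/

section
open Finset
variable {V : Type*} [Fintype V] [DecidableEq V] (G : SimpleGraph V) [DecidableRel G.Adj] (M : ℕ)

open Classical in
/-- The maximal cliques with at least `M` vertices. -/
noncomputable def bigCliques : Finset (Finset V) := {F | Maximal G.IsClique (F : Set V) ∧ M ≤ #F}

omit [DecidableEq V] [DecidableRel G.Adj] in
theorem mem_bigCliques {F : Finset V} :
    F ∈ bigCliques G M ↔ Maximal G.IsClique (F : Set V) ∧ M ≤ #F := by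
  simp [bigCliques]

/-- The number of maximal cliques with at least `M` vertices that contain two given vertices. -/
noncomputable def cliqueCodegree (x y : V) : ℕ := #{F ∈ bigCliques G M | x ∈ F ∧ y ∈ F}

/-- The entries outside the diagonal of the special matrix of the Hoffman graph whose fat vertices
are the maximal cliques with at least `M` vertices. -/
noncomputable def cliqueEntry (x y : V) : ℤ :=
  (if G.Adj x y then 1 else 0) - cliqueCodegree G M x y

omit [DecidableRel G.Adj] in
theorem cliqueCodegree_comm (x y : V) : cliqueCodegree G M x y = cliqueCodegree G M y x := by
  simp only [cliqueCodegree, and_comm]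

theorem cliqueEntry_comm (x y : V) : cliqueEntry G M x y = cliqueEntry G M y x := by
  simp only [cliqueEntry, cliqueCodegree_comm G M x y, G.adj_comm x y]

variable {G M} {c : ℕ} {θ : ℝ}

/-- Four large cliques through `x` would give `4 ≤ θ` plus the error, by testing the unit vector at
`x`. -/
theorem cliqueCodegree_self_le (hG : IsMuBounded G c) (hM : 0 < M) (hθ : 1 ≤ θ)
    (hlam : -θ ≤ lambdaMin G) (herr : θ + (2 * c + θ) / M * 2475 < 4) (x : V) :
    cliqueCodegree G M x x ≤ 3 := by
  by_contra! hcon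
  obtain ⟨s, hs, hcard⟩ := exists_subset_card_eq (Nat.succ_le_of_lt hcon)
  have hs' : ∀ F ∈ s, F ∈ bigCliques G M ∧ x ∈ F := fun F hF => by
    have := mem_filter.1 (hs hF)
    exact ⟨this.1, this.2.1⟩
  have h := sum_sq_sum_le_shiftedForm hG hM hθ hlam s
    (fun F hF => (mem_bigCliques G M).1 (hs' F hF).1) (by omega) (Pi.single x 1)
    (by simp [Pi.single_apply, apply_ite abs])
  rw [sum_congr rfl (g := fun _ => (1 : ℝ)) fun F hF => by
    simp [Pi.single_apply, (hs' F hF).2]] at h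
  simp only [shiftedForm, Matrix.toBilin'_single] at h
  simp [hcard] at h
  linarith

/-- The approximate Bessel inequality for the vector with values `a`, `b`, `d` at `x`, `y`, `z`. The
case `y = z`, `d = 0` is admitted, so that two-vertex tests are covered too. -/
theorem quadratic_cliqueCodegree_le (hG : IsMuBounded G c) (hM : 0 < M) (hθ : 1 ≤ θ)
    (hlam : -θ ≤ lambdaMin G) (h3 : ∀ x, cliqueCodegree G M x x ≤ 3) {x y z : V}
    (hxy : x ≠ y) (hxz : x ≠ z) (a b d : ℝ) (habd : |a| + |b| + |d| ≤ 5) (hyz : b * d = 0 ∨ y ≠ z) :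
    a ^ 2 * cliqueCodegree G M x x + b ^ 2 * cliqueCodegree G M y y +
      d ^ 2 * cliqueCodegree G M z z ≤ θ * (a ^ 2 + b ^ 2 + d ^ 2) +
        2 * (a * b) * cliqueEntry G M x y + 2 * (a * d) * cliqueEntry G M x z +
        2 * (b * d) * cliqueEntry G M y z + (2 * c + θ) / M * 2475 := by
  set p : V → ℝ := a • Pi.single x 1 + b • Pi.single y 1 + d • Pi.single z 1 with hp
  have hsum : ∀ F : Finset V, ∑ v ∈ F, p v =
      a * (if x ∈ F then 1 else 0) + b * (if y ∈ F then 1 else 0) +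
        d * (if z ∈ F then 1 else 0) := by
    intro F
    simp [hp, sum_add_distrib, Pi.single_apply]
  have hnorm : ∑ v, |p v| ≤ 5 := by
    refine le_trans ?_ habd
    have : ∀ v, |p v| ≤ |a| * (if v = x then 1 else 0) + |b| * (if v = y then 1 else 0) +
        |d| * (if v = z then 1 else 0) := by
      intro v
      simp only [hp, Pi.add_apply, Pi.smul_apply, Pi.single_apply, smul_eq_mul]
      refine (abs_add_three _ _ _).trans (le_of_eq ?_)
      simp [apply_ite abs]
    refine (sum_le_sum fun v _ => this v).trans (le_of_eq ?_)
    simp [sum_add_distrib]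
  have hform : shiftedForm G θ p p = θ * (a ^ 2 + b ^ 2 + d ^ 2) +
      2 * (a * b) * (if G.Adj x y then 1 else 0) + 2 * (a * d) * (if G.Adj x z then 1 else 0) +
      2 * (b * d) * (if G.Adj y z then 1 else 0) := by
    have hs : ∀ v w, shiftedForm G θ (Pi.single v 1) (Pi.single w 1) =
        (if G.Adj v w then 1 else 0) + if v = w then θ else 0 := by
      intro v w
      simp [shiftedForm, Matrix.one_apply]
    simp only [hp, LinearMap.BilinForm.add_left, LinearMap.BilinForm.add_right,
      LinearMap.BilinForm.smul_left, LinearMap.BilinForm.smul_right, hs, G.adj_comm y x,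
      G.adj_comm z x, G.adj_comm z y, eq_comm (a := z), eq_comm (a := y) (b := x), hxy, hxz,
      if_true, if_false, G.irrefl]
    rcases hyz with h | h
    · linear_combination (2 * (if G.Adj y z then 1 else 0) + 2 * (if y = z then θ else 0) -
        2 * (if G.Adj y z then 1 else 0)) * h
    · simp only [h, if_false]
      ring
  set s : Finset (Finset V) := {F ∈ bigCliques G M | (x ∈ F ∧ x ∈ F) ∨ (y ∈ F ∧ y ∈ F) ∨
    (z ∈ F ∧ z ∈ F)} with hs
  have hcard : #s ≤ 9 := by
    rw [hs, filter_or, filter_or]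
    have h1 := h3 x
    have h2 := h3 y
    have h4 := h3 z
    unfold cliqueCodegree at h1 h2 h4
    have h5 := card_union_le ({F ∈ bigCliques G M | x ∈ F ∧ x ∈ F})
      ({F ∈ bigCliques G M | y ∈ F ∧ y ∈ F} ∪ {F ∈ bigCliques G M | z ∈ F ∧ z ∈ F})
    have h6 := card_union_le {F ∈ bigCliques G M | y ∈ F ∧ y ∈ F}
      {F ∈ bigCliques G M | z ∈ F ∧ z ∈ F}
    omega
  have h := sum_sq_sum_le_shiftedForm hG hM hθ hlam s
    (fun F hF => (mem_bigCliques G M).1 (mem_filter.1 hF).1) hcard p hnorm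
  have hext : ∑ F ∈ s, (∑ v ∈ F, p v) ^ 2 = ∑ F ∈ bigCliques G M, (∑ v ∈ F, p v) ^ 2 := by
    refine sum_subset (filter_subset _ _) fun F hF hFs => ?_
    have : x ∉ F ∧ y ∉ F ∧ z ∉ F := by
      simp only [hs, mem_filter] at hFs
      tauto
    rw [hsum]
    simp [this]
  have hcod : ∀ v w, (cliqueCodegree G M v w : ℝ) =
      ∑ F ∈ bigCliques G M, (if v ∈ F then 1 else 0) * (if w ∈ F then 1 else 0) := by
    intro v w
    simp [cliqueCodegree, ← ite_and, sum_boole, and_comm]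
  have hsq : ∑ F ∈ bigCliques G M, (∑ v ∈ F, p v) ^ 2 = a ^ 2 * cliqueCodegree G M x x +
      b ^ 2 * cliqueCodegree G M y y + d ^ 2 * cliqueCodegree G M z z +
      2 * (a * b) * cliqueCodegree G M x y + 2 * (a * d) * cliqueCodegree G M x z +
      2 * (b * d) * cliqueCodegree G M y z := by
    simp only [hcod, mul_sum, ← sum_add_distrib, hsum]
    exact sum_congr rfl fun F _ => by ring
  rw [hext, hsq, hform] at h
  simp only [cliqueEntry]
  push_cast
  linarith
end

/-- The local conditions on the large maximal cliques of a graph that follow from a bound on the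
smallest eigenvalue. -/
structure IsCliqueLocal {V : Type*} [Fintype V] [DecidableEq V] (G : SimpleGraph V)
    [DecidableRel G.Adj] (M : ℕ) : Prop where
  two_le : ∀ x, 2 ≤ cliqueCodegree G M x x
  le_three : ∀ x, cliqueCodegree G M x x ≤ 3
  entry_eq_zero : ∀ x y, x ≠ y → cliqueCodegree G M x x = 3 → cliqueEntry G M x y = 0
  mul_eq_one : ∀ x y z, x ≠ y → x ≠ z → y ≠ z → cliqueEntry G M x y ≠ 0 →
    cliqueEntry G M x z ≠ 0 →
      cliqueEntry G M x y * cliqueEntry G M x z * cliqueEntry G M y z = 1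

section
open Finset
variable {V : Type*} [Fintype V] [DecidableEq V] {G : SimpleGraph V} [DecidableRel G.Adj] {M : ℕ}

omit [DecidableRel G.Adj] in
theorem cliqueCodegree_le_self (x y : V) : cliqueCodegree G M x y ≤ cliqueCodegree G M x x :=
  card_le_card (monotone_filter_right _ fun _ _ h => ⟨h.1, h.1⟩)

omit [DecidableRel G.Adj] in
theorem adj_of_cliqueCodegree_ne_zero {x y : V} (hxy : x ≠ y) (h : cliqueCodegree G M x y ≠ 0) :
    G.Adj x y := by
  obtain ⟨F, hF⟩ := card_ne_zero.1 h
  rw [mem_filter, mem_bigCliques] at hF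
  exact hF.1.1.prop hF.2.1 hF.2.2 hxy

/-- A vertex with a nonzero entry lies in exactly two large cliques, so the codegree is at most 2; a
positive codegree forces adjacency. Only the codegrees 0 and 2 then leave a nonzero entry. -/
theorem cliqueEntry_eq_of_codegree_eq_two
    (h0 : ∀ x y, x ≠ y → cliqueCodegree G M x x = 3 → cliqueEntry G M x y = 0)
    (h2 : ∀ x, 2 ≤ cliqueCodegree G M x x) (h3 : ∀ x, cliqueCodegree G M x x ≤ 3)
    {x y : V} (hxy : x ≠ y) (h : cliqueEntry G M x y ≠ 0) :
    cliqueCodegree G M x x = 2 ∧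
      ((cliqueEntry G M x y = 1 ∧ G.Adj x y ∧ cliqueCodegree G M x y = 0) ∨
        (cliqueEntry G M x y = -1 ∧ G.Adj x y ∧ cliqueCodegree G M x y = 2)) := by
  have hx : cliqueCodegree G M x x = 2 := by
    have := h2 x
    have := h3 x
    have : cliqueCodegree G M x x ≠ 3 := fun h' => h (h0 x y hxy h')
    omega
  refine ⟨hx, ?_⟩
  have hle := cliqueCodegree_le_self (G := G) (M := M) x y
  have hadj := adj_of_cliqueCodegree_ne_zero (G := G) (M := M) hxy
  unfold cliqueEntry at h ⊢
  by_cases hA : G.Adj x y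
  · simp only [hA, if_true, true_and] at h ⊢
    omega
  · have hc : cliqueCodegree G M x y = 0 := by_contra fun h' => hA (hadj h')
    exact absurd (by simp [hA, hc]) h

theorem isCliqueLocal_of_lambdaMin {c : ℕ} {ε : ℝ} (hG : IsMuBounded G c) (hM : 0 < M)
    (hε : 0 < ε) (hε' : ε ≤ 1 / 10) (hlam : -2 - √2 + ε ≤ lambdaMin G)
    (herr : (2 * c + 4) / M * 2475 ≤ ε) (h2 : ∀ x, 2 ≤ cliqueCodegree G M x x) :
    IsCliqueLocal G M := by
  have hs1 : √2 < 1.4143 := by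
    rw [Real.sqrt_lt' (by norm_num)]; norm_num
  have hs2 : 1 ≤ √2 := by
    rw [Real.le_sqrt' (by norm_num)]; norm_num
  have hs3 : √2 ^ 2 = 2 := Real.sq_sqrt (by norm_num)
  have hMpos : (0 : ℝ) < M := by exact_mod_cast hM
  obtain ⟨θ, hθdef⟩ : ∃ θ, θ = 2 + √2 - ε := ⟨_, rfl⟩
  have hθ : 1 ≤ θ := by linarith
  have hlam' : -θ ≤ lambdaMin G := by linarith
  have herr' : (2 * c + θ) / M * 2475 ≤ ε := by
    refine le_trans (mul_le_mul_of_nonneg_right (div_le_div_of_nonneg_right ?_ hMpos.le)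
      (by norm_num)) herr
    linarith
  have h3 : ∀ x, cliqueCodegree G M x x ≤ 3 :=
    cliqueCodegree_self_le hG hM hθ hlam' (by linarith)
  have hquad := fun x y z hxy hxz a b d habd hyz =>
    quadratic_cliqueCodegree_le (x := x) (y := y) (z := z) hG hM hθ hlam' h3 hxy hxz a b d habd hyz
  have h2r : ∀ x, (2 : ℝ) ≤ cliqueCodegree G M x x := fun x => by exact_mod_cast h2 x
  have h0 : ∀ x y, x ≠ y → cliqueCodegree G M x x = 3 → cliqueEntry G M x y = 0 := by
    intro x y hxy hx
    by_contra hne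
    have hy := h2r y
    rcases lt_or_gt_of_ne hne with h | h
    · have hh : (cliqueEntry G M x y : ℝ) ≤ -1 := by exact_mod_cast Int.le_sub_one_of_lt h
      -- The matrix with rows `(3, ±1)` and `(±1, 2)` has the eigenvalue `(5 + √5) / 2 > 2 + √2`,
      -- and `(2, ±1)` is close enough to its eigenvector.
      have := hquad x y y hxy hxy 2 1 0 (by norm_num) (Or.inl (by norm_num))
      rw [hx] at this
      push_cast at this
      linarith
    · have hh : (1 : ℝ) ≤ cliqueEntry G M x y := by exact_mod_cast h
      have := hquad x y y hxy hxy 2 (-1) 0 (by norm_num) (Or.inl (by norm_num))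
      rw [hx] at this
      push_cast at this
      linarith
  refine ⟨h2, h3, h0, ?_⟩
  intro x y z hxy hxz hyz hTy hTz
  have ey := (cliqueEntry_eq_of_codegree_eq_two h0 h2 h3 hxy hTy).2
  have ez := (cliqueEntry_eq_of_codegree_eq_two h0 h2 h3 hxz hTz).2
  have hx2 := h2r x
  have hy2 := h2r y
  have hz2 := h2r z
  have hTyz : cliqueEntry G M y z ≠ 0 := by
    intro h
    -- A signed path centred at `x` with diagonal -2 has smallest eigenvalue exactly `-2 - √2`, with
    -- eigenvector `(√2, s, t)`. This is where the threshold of the theorem comes from.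
    have key : ∀ s t : ℝ, |s| = 1 → |t| = 1 → s * cliqueEntry G M x y = -1 →
        t * cliqueEntry G M x z = -1 → False := by
      intro s t hs ht h1 h2
      have := hquad x y z hxy hxz (√2) s t
        (by rw [abs_of_nonneg (by linarith), hs, ht]; linarith) (Or.inr hyz)
      rw [h, hs3, ← sq_abs s, ← sq_abs t, hs, ht] at this
      have e1 : 2 * (√2 * s) * cliqueEntry G M x y = -2 * √2 := by
        linear_combination 2 * √2 * h1
      have e2 : 2 * (√2 * t) * cliqueEntry G M x z = -2 * √2 := by
        linear_combination 2 * √2 * h2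
      rw [e1, e2] at this
      push_cast at this
      linarith
    rcases ey with ey | ey <;> rcases ez with ez | ez
    · exact key (-1) (-1) (by norm_num) (by norm_num) (by simp [ey.1]) (by simp [ez.1])
    · exact key (-1) 1 (by norm_num) (by norm_num) (by simp [ey.1]) (by simp [ez.1])
    · exact key 1 (-1) (by norm_num) (by norm_num) (by simp [ey.1]) (by simp [ez.1])
    · exact key 1 1 (by norm_num) (by norm_num) (by simp [ey.1]) (by simp [ez.1])
  have eyz := (cliqueEntry_eq_of_codegree_eq_two h0 h2 h3 hyz hTyz).2
  have h1 := hquad x y z hxy hxz 1 1 1 (by norm_num) (Or.inr hyz)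
  have h2 := hquad x y z hxy hxz 1 1 (-1) (by norm_num) (Or.inr hyz)
  have h3 := hquad x y z hxy hxz 1 (-1) 1 (by norm_num) (Or.inr hyz)
  have h4 := hquad x y z hxy hxz 1 (-1) (-1) (by norm_num) (Or.inr hyz)
  -- A triangle with product -1 has eigenvalue -4, attained by a vector with entries ±1; up to sign
  -- these are the four vectors tested.
  rcases ey with ey | ey <;> rcases ez with ez | ez <;> rcases eyz with eyz | eyz <;>
    rw [ey.1, ez.1, eyz.1] at h1 h2 h3 h4 ⊢ <;> first | (norm_num; done) | (exfalso; push_cast at *; linarith)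
end

/-! ### Structure of the entries -1 and 1 -/

section
open Finset
variable {V : Type*} [Fintype V] [DecidableEq V] {G : SimpleGraph V} [DecidableRel G.Adj] {M : ℕ}

theorem cliqueEntry_self (x : V) : cliqueEntry G M x x = - cliqueCodegree G M x x := by
  simp [cliqueEntry]

namespace IsCliqueLocal

theorem entry_ne_zero_cases (h : IsCliqueLocal G M) {x y : V} (hxy : x ≠ y)
    (hT : cliqueEntry G M x y ≠ 0) : cliqueCodegree G M x x = 2 ∧
      ((cliqueEntry G M x y = 1 ∧ G.Adj x y ∧ cliqueCodegree G M x y = 0) ∨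
        (cliqueEntry G M x y = -1 ∧ G.Adj x y ∧ cliqueCodegree G M x y = 2)) :=
  cliqueEntry_eq_of_codegree_eq_two h.entry_eq_zero h.two_le h.le_three hxy hT

theorem ne_of_entry_eq_one {x y : V} (hT : cliqueEntry G M x y = 1) : x ≠ y := by
  rintro rfl
  rw [cliqueEntry_self] at hT
  omega

theorem ne_of_entry_eq_neg_one (h : IsCliqueLocal G M) {x y : V}
    (hT : cliqueEntry G M x y = -1) : x ≠ y := by
  rintro rfl
  rw [cliqueEntry_self] at hT
  have := h.two_le x
  omega

theorem of_entry_eq_one (h : IsCliqueLocal G M) {x y : V} (hT : cliqueEntry G M x y = 1) :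
    G.Adj x y ∧ cliqueCodegree G M x y = 0 ∧ cliqueCodegree G M x x = 2 := by
  obtain ⟨h1, h2 | h2⟩ := h.entry_ne_zero_cases (ne_of_entry_eq_one hT) (by omega)
  · exact ⟨h2.2.1, h2.2.2, h1⟩
  · omega

theorem of_entry_eq_neg_one (h : IsCliqueLocal G M) {x y : V} (hT : cliqueEntry G M x y = -1) :
    G.Adj x y ∧ cliqueCodegree G M x y = 2 ∧ cliqueCodegree G M x x = 2 := by
  obtain ⟨h1, h2 | h2⟩ := h.entry_ne_zero_cases (h.ne_of_entry_eq_neg_one hT) (by omega)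
  · omega
  · exact ⟨h2.2.1, h2.2.2, h1⟩

/-- The two common large cliques are all the large cliques through either vertex. -/
theorem mem_iff_mem_of_entry_eq_neg_one (h : IsCliqueLocal G M) {x y : V}
    (hT : cliqueEntry G M x y = -1) {F : Finset V} (hF : F ∈ bigCliques G M) :
    x ∈ F ↔ y ∈ F := by
  have key : ∀ x y : V, cliqueEntry G M x y = -1 → x ∈ F → y ∈ F := by
    intro x y hT hx
    obtain ⟨-, h1, h2⟩ := h.of_entry_eq_neg_one hT
    have heq : ({F ∈ bigCliques G M | x ∈ F ∧ y ∈ F} : Finset _) =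
        {F ∈ bigCliques G M | x ∈ F ∧ x ∈ F} :=
      eq_of_subset_of_card_le (monotone_filter_right _ fun _ _ h => ⟨h.1, h.1⟩)
        (by unfold cliqueCodegree at h1 h2; omega)
    have hmem : F ∈ ({F ∈ bigCliques G M | x ∈ F ∧ x ∈ F} : Finset _) := by simp [hF, hx]
    rw [← heq, mem_filter] at hmem
    exact hmem.2.2
  exact ⟨key x y hT, key y x (cliqueEntry_comm G M x y ▸ hT)⟩

/-- Since `x` and `y` lie in the same large cliques, nonzero entries at `(x, z)` and `(y, z)` have
equal sign, so the product over the triangle would be -1. -/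
theorem entry_eq_zero_of_entry_eq_neg_one (h : IsCliqueLocal G M) {x y z : V}
    (hT : cliqueEntry G M x y = -1) (hxz : x ≠ z) (hyz : y ≠ z) : cliqueEntry G M x z = 0 := by
  by_contra hz
  have hxy := h.ne_of_entry_eq_neg_one hT
  have hmul := h.mul_eq_one x y z hxy hxz hyz (by omega) hz
  have hcod : cliqueCodegree G M x z = cliqueCodegree G M y z := by
    unfold cliqueCodegree
    congr 1
    refine filter_congr fun F hF => ?_
    rw [h.mem_iff_mem_of_entry_eq_neg_one hT hF]
  have hyz0 : cliqueEntry G M y z ≠ 0 := by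
    intro h0
    rw [h0] at hmul
    omega
  obtain ⟨-, h1 | h1⟩ := h.entry_ne_zero_cases hxz hz <;>
    obtain ⟨-, h2 | h2⟩ := h.entry_ne_zero_cases hyz hyz0
  · rw [hT, h1.1, h2.1] at hmul
    omega
  · omega
  · omega
  · rw [hT, h1.1, h2.1] at hmul
    omega

theorem entry_eq_one_trans (h : IsCliqueLocal G M) {x y z : V} (hy : cliqueEntry G M x y = 1)
    (hz : cliqueEntry G M x z = 1) (hyz : y ≠ z) : cliqueEntry G M y z = 1 := by
  have := h.mul_eq_one x y z (ne_of_entry_eq_one hy) (ne_of_entry_eq_one hz) hyz (by omega)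
    (by omega)
  rwa [hy, hz, one_mul, one_mul] at this

/-- Three common vertices would give one of them two different partners with entry -1. -/
theorem card_inter_le_two (h : IsCliqueLocal G M) {F F' : Finset V} (hF : F ∈ bigCliques G M)
    (hF' : F' ∈ bigCliques G M) (hne : F ≠ F') : #(F ∩ F') ≤ 2 := by
  by_contra! hcon
  obtain ⟨a, ha, b, hb, d, hd, hab, had, hbd⟩ := two_lt_card.1 hcon
  have key : ∀ b ∈ F ∩ F', a ≠ b → cliqueEntry G M a b = -1 := by
    intro b hb hab
    rw [mem_inter] at ha hb
    have hle : #({F, F'} : Finset (Finset V)) ≤ cliqueCodegree G M a b := by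
      refine card_le_card fun E hE => ?_
      rw [mem_insert, mem_singleton] at hE
      rcases hE with rfl | rfl
      · exact mem_filter.2 ⟨hF, ha.1, hb.1⟩
      · exact mem_filter.2 ⟨hF', ha.2, hb.2⟩
    rw [card_pair hne] at hle
    have hadj : G.Adj a b := adj_of_cliqueCodegree_ne_zero (M := M) hab (by omega)
    have hent : cliqueEntry G M a b = 1 - cliqueCodegree G M a b := by simp [cliqueEntry, hadj]
    obtain ⟨-, h1 | h1⟩ := h.entry_ne_zero_cases hab (by omega)
    · omega
    · exact h1.1
  have h1 := key b hb hab
  have h2 := key d hd had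
  have h3 := h.entry_eq_zero_of_entry_eq_neg_one h1 had hbd
  omega

/-- At most one neighbour in `F` has entry 1 with `z`, as two of them would have entry 1 while
sharing `F`. The others lie in at most three large cliques through `z`, each meeting `F` at most
twice: `1 + 3 * 2 = 7`. Unlike the bound `c`, this is absolute. -/
theorem card_filter_adj_le_seven (h : IsCliqueLocal G M) {F : Finset V}
    (hF : F ∈ bigCliques G M) {z : V} (hz : z ∉ F) : #{y ∈ F | G.Adj z y} ≤ 7 := by
  have hsub : ({y ∈ F | G.Adj z y} : Finset V) ⊆ {y ∈ F | cliqueEntry G M z y = 1} ∪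
      ({F' ∈ bigCliques G M | z ∈ F' ∧ z ∈ F'} : Finset _).biUnion (fun F' => F ∩ F') := by
    intro y hy
    rw [mem_filter] at hy
    rw [mem_union, mem_biUnion]
    by_cases hc : cliqueCodegree G M z y = 0
    · exact Or.inl (mem_filter.2 ⟨hy.1, by simp [cliqueEntry, hy.2, hc]⟩)
    · obtain ⟨F', hF'⟩ := card_ne_zero.1 hc
      rw [mem_filter] at hF'
      exact Or.inr ⟨F', mem_filter.2 ⟨hF'.1, hF'.2.1, hF'.2.1⟩, mem_inter.2 ⟨hy.1, hF'.2.2⟩⟩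
  have h1 : #{y ∈ F | cliqueEntry G M z y = 1} ≤ 1 := by
    rw [card_le_one]
    intro a ha b hb
    rw [mem_filter] at ha hb
    by_contra hab
    have h2 := (h.of_entry_eq_one (h.entry_eq_one_trans ha.2 hb.2 hab)).2.1
    exact card_ne_zero.2 ⟨F, mem_filter.2 ⟨hF, ha.1, hb.1⟩⟩ h2
  have h2 : #(({F' ∈ bigCliques G M | z ∈ F' ∧ z ∈ F'} : Finset _).biUnion
      (fun F' => F ∩ F')) ≤ cliqueCodegree G M z z * 2 := by
    refine card_biUnion_le_card_mul _ _ _ fun F' hF' => ?_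
    rw [mem_filter] at hF'
    exact h.card_inter_le_two hF hF'.1 (by rintro rfl; exact hz hF'.2.1)
  have h3 := h.le_three z
  exact (card_le_card hsub).trans ((card_union_le _ _).trans (by omega))

end IsCliqueLocal

/-! ### Plus classes and maximal cliques of medium size -/

variable (G M) in
/-- A vertex `x` together with its neighbours with which it shares no large maximal clique, if it
lies in just two of these. -/
noncomputable def plusClass (x : V) : Finset V := {y | y = x ∨ cliqueEntry G M x y = 1}

theorem mem_plusClass {x y : V} : y ∈ plusClass G M x ↔ y = x ∨ cliqueEntry G M x y = 1 := by
  simp [plusClass]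

namespace IsCliqueLocal

theorem plusClass_eq_of_mem (h : IsCliqueLocal G M) {x y : V} (hy : y ∈ plusClass G M x) :
    plusClass G M y = plusClass G M x := by
  have key : ∀ x y, y ∈ plusClass G M x → plusClass G M x ⊆ plusClass G M y := by
    intro x y hy z hz
    rw [mem_plusClass] at *
    rcases hy with rfl | hy
    · exact hz
    · by_cases hzy : z = y
      · exact Or.inl hzy
      · rcases hz with rfl | hz
        · exact Or.inr (by rwa [cliqueEntry_comm])
        · exact Or.inr (h.entry_eq_one_trans hy hz (Ne.symm hzy))
  refine (key y x ?_).antisymm (key x y hy)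
  rw [mem_plusClass] at *
  rw [cliqueEntry_comm, eq_comm]
  exact hy

theorem entry_eq_one_of_mem_plusClass (h : IsCliqueLocal G M) {x y z : V}
    (hy : y ∈ plusClass G M x) (hz : z ∈ plusClass G M x) (hyz : y ≠ z) :
    cliqueEntry G M y z = 1 := by
  rw [← h.plusClass_eq_of_mem hy, mem_plusClass] at hz
  exact hz.resolve_left hyz.symm

theorem isClique_plusClass (h : IsCliqueLocal G M) (x : V) :
    G.IsClique (plusClass G M x : Set V) := fun _ hy _ hz hyz =>
  (h.of_entry_eq_one (h.entry_eq_one_of_mem_plusClass hy hz hyz)).1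

/-- A vertex of `C` outside the plus class shares one of at most three large cliques with `x`. Each
of these misses some vertex of `C`, so it meets `C` in at most seven vertices. -/
theorem card_sdiff_plusClass_le (h : IsCliqueLocal G M) {C : Finset V}
    (hC : Maximal G.IsClique (C : Set V)) (hCM : #C < M) {x : V} (hx : x ∈ C) :
    #(C \ plusClass G M x) ≤ 21 := by
  have hsub : C \ plusClass G M x ⊆
      ({F ∈ bigCliques G M | x ∈ F ∧ x ∈ F} : Finset _).biUnion (fun F => C ∩ F) := by
    intro y hy
    rw [mem_sdiff, mem_plusClass, not_or] at hy
    have hadj : G.Adj x y := hC.prop hx hy.1 (Ne.symm hy.2.1)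
    have hc : cliqueCodegree G M x y ≠ 0 := fun hc => hy.2.2 (by simp [cliqueEntry, hadj, hc])
    obtain ⟨F, hF⟩ := card_ne_zero.1 hc
    rw [mem_filter] at hF
    exact mem_biUnion.2 ⟨F, mem_filter.2 ⟨hF.1, hF.2.1, hF.2.1⟩, mem_inter.2 ⟨hy.1, hF.2.2⟩⟩
  have h2 : #(({F ∈ bigCliques G M | x ∈ F ∧ x ∈ F} : Finset _).biUnion
      (fun F => C ∩ F)) ≤ cliqueCodegree G M x x * 7 := by
    refine card_biUnion_le_card_mul _ _ _ fun F hF => ?_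
    rw [mem_filter] at hF
    have hF' := (mem_bigCliques G M).1 hF.1
    obtain ⟨z, hz, hzF⟩ := exists_mem_notMem_of_maximal_isClique hF'.1 hC
      (by rintro rfl; omega)
    refine le_trans (card_le_card fun y hy => ?_) (h.card_filter_adj_le_seven hF.1 hzF)
    rw [mem_inter] at hy
    exact mem_filter.2 ⟨hy.2, hC.prop hz hy.1 (by rintro rfl; exact hzF hy.2)⟩
  have h3 := h.le_three x
  exact (card_le_card hsub).trans (h2.trans (by omega))

/-- Maximal cliques of medium size are classes of the relation `cliqueEntry G M x y = 1`. -/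
theorem eq_plusClass (h : IsCliqueLocal G M) {C : Finset V}
    (hC : Maximal G.IsClique (C : Set V)) (hCM : #C < M) (hcard : 42 < #C) {x : V} (hx : x ∈ C) :
    C = plusClass G M x := by
  have hsub : C ⊆ plusClass G M x := by
    intro y hy
    have h1 := h.card_sdiff_plusClass_le hC hCM hx
    have h2 := h.card_sdiff_plusClass_le hC hCM hy
    -- The two exceptional sets have at most `21 + 21 = 42` vertices, so some `w` in `C` lies in the
    -- plus classes of both `x` and `y`.
    obtain ⟨w, hw, hw'⟩ : ∃ w ∈ C, w ∉ (C \ plusClass G M x) ∪ (C \ plusClass G M y) :=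
      exists_mem_notMem_of_card_lt_card (lt_of_le_of_lt (card_union_le _ _) (by omega))
    simp only [mem_union, mem_sdiff, not_or, not_and, not_not] at hw'
    rw [← h.plusClass_eq_of_mem (hw'.1 hw), h.plusClass_eq_of_mem (hw'.2 hw), mem_plusClass]
    exact Or.inl rfl
  exact hsub.antisymm (by exact_mod_cast hC.le_of_ge (h.isClique_plusClass x) hsub)

end IsCliqueLocal

/-! ### The extended clique family and the bound -3 -/

variable (G M) in
/-- The large maximal cliques together with the classes with at least two elements of the relation
`cliqueEntry G M x y = 1`. -/
noncomputable def lineCliques : Finset (Finset V) :=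
  bigCliques G M ∪ ({x | ∃ y, cliqueEntry G M x y = 1} : Finset V).image (plusClass G M)

namespace IsCliqueLocal

/-- The only added set through `x` is its own plus class, when nontrivial. It is not a large clique
already, because its distinct members share none. -/
theorem card_filter_lineCliques (h : IsCliqueLocal G M) (x y : V) :
    #{F ∈ lineCliques G M | x ∈ F ∧ y ∈ F} = cliqueCodegree G M x y +
      if (∃ w, cliqueEntry G M x w = 1) ∧ y ∈ plusClass G M x then 1 else 0 := by
  rw [lineCliques, filter_union, card_union_of_disjoint]
  · congr 1
    have hmem : ∀ F : Finset V,
        (F ∈ ({x | ∃ y, cliqueEntry G M x y = 1} : Finset V).image (plusClass G M) ∧ x ∈ F) ↔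
          F = plusClass G M x ∧ ∃ w, cliqueEntry G M x w = 1 := by
      intro F
      simp only [mem_image, mem_filter, mem_univ, true_and]
      constructor
      · rintro ⟨⟨z, ⟨w, hw⟩, rfl⟩, hx⟩
        refine ⟨(h.plusClass_eq_of_mem hx).symm, ?_⟩
        by_cases hxz : x = z
        · exact ⟨w, hxz ▸ hw⟩
        · exact ⟨z, h.entry_eq_one_of_mem_plusClass hx (mem_plusClass.2 (Or.inl rfl)) hxz⟩
      · rintro ⟨rfl, hw⟩
        exact ⟨⟨x, hw, rfl⟩, mem_plusClass.2 (Or.inl rfl)⟩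
    have hset : ({F ∈ ({x | ∃ y, cliqueEntry G M x y = 1} : Finset V).image (plusClass G M) |
        x ∈ F ∧ y ∈ F} : Finset _) =
        if (∃ w, cliqueEntry G M x w = 1) ∧ y ∈ plusClass G M x then {plusClass G M x} else ∅ := by
      ext F
      rw [mem_filter, ← and_assoc, hmem]
      split_ifs with hif
      · rw [mem_singleton]
        constructor
        · exact fun h => h.1.1
        · rintro rfl
          exact ⟨⟨rfl, hif.1⟩, hif.2⟩
      · simp only [notMem_empty, iff_false]
        rintro ⟨⟨rfl, h1⟩, h2⟩
        exact hif ⟨h1, h2⟩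
    rw [hset]
    split_ifs <;> simp
  · rw [disjoint_left]
    intro F hF hF'
    rw [mem_filter] at hF hF'
    obtain ⟨z, hz, rfl⟩ := mem_image.1 hF'.1
    obtain ⟨w, hw⟩ := (mem_filter.1 hz).2
    exact card_ne_zero.2 ⟨plusClass G M z, mem_filter.2 ⟨hF.1, mem_plusClass.2 (Or.inl rfl),
      mem_plusClass.2 (Or.inr hw)⟩⟩ (h.of_entry_eq_one hw).2.1

theorem card_filter_lineCliques_self_le (h : IsCliqueLocal G M) (x : V) :
    #{F ∈ lineCliques G M | x ∈ F ∧ x ∈ F} ≤ 3 := by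
  rw [h.card_filter_lineCliques]
  have h3 := h.le_three x
  split_ifs with hw
  · obtain ⟨⟨w, hw⟩, -⟩ := hw
    have := (h.of_entry_eq_one hw).2.2
    omega
  · omega

/-- The added sets cancel exactly the entries 1, so only the entries -1 survive off the diagonal. -/
theorem card_filter_lineCliques_eq_ite (h : IsCliqueLocal G M) {x y : V} (hxy : x ≠ y)
    (hT : cliqueEntry G M x y ≠ -1) :
    #{F ∈ lineCliques G M | x ∈ F ∧ y ∈ F} = if G.Adj x y then 1 else 0 := by
  rw [h.card_filter_lineCliques]
  have hcond : ((∃ w, cliqueEntry G M x w = 1) ∧ y ∈ plusClass G M x) ↔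
      cliqueEntry G M x y = 1 := by
    rw [mem_plusClass]
    exact ⟨fun h => h.2.resolve_left hxy.symm, fun h => ⟨⟨y, h⟩, Or.inr h⟩⟩
  simp only [hcond]
  by_cases h0 : cliqueEntry G M x y = 0
  · rw [if_neg (by omega)]
    unfold cliqueEntry at h0
    zify
    linarith
  · obtain ⟨-, h1 | h1⟩ := h.entry_ne_zero_cases hxy h0
    · simp [h1]
    · exact absurd h1.1 hT

/-- Entries -1 are isolated, so neither vertex of such a pair has an entry 1 and no set is added
through it. -/
theorem card_filter_lineCliques_of_entry_eq_neg_one (h : IsCliqueLocal G M) {x y : V}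
    (hT : cliqueEntry G M x y = -1) : #{F ∈ lineCliques G M | x ∈ F ∧ y ∈ F} = 2 ∧
      #{F ∈ lineCliques G M | x ∈ F ∧ x ∈ F} = 2 := by
  rw [h.card_filter_lineCliques, h.card_filter_lineCliques]
  obtain ⟨-, h1, h2⟩ := h.of_entry_eq_neg_one hT
  have hno : ¬ ∃ w, cliqueEntry G M x w = 1 := by
    rintro ⟨w, hw⟩
    by_cases hyw : y = w
    · subst hyw
      omega
    · have := h.entry_eq_zero_of_entry_eq_neg_one hT (ne_of_entry_eq_one hw) hyw
      omega
  simp [hno, h1, h2]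

theorem mem_lineCliques_iff_of_entry_eq_neg_one (h : IsCliqueLocal G M) {x y : V}
    (hT : cliqueEntry G M x y = -1) {F : Finset V} (hF : F ∈ lineCliques G M) :
    x ∈ F ↔ y ∈ F := by
  have key : ∀ x y : V, cliqueEntry G M x y = -1 → x ∈ F → y ∈ F := by
    intro x y hT hx
    obtain ⟨h1, h2⟩ := h.card_filter_lineCliques_of_entry_eq_neg_one hT
    have heq : ({F ∈ lineCliques G M | x ∈ F ∧ y ∈ F} : Finset _) =
        {F ∈ lineCliques G M | x ∈ F ∧ x ∈ F} :=
      eq_of_subset_of_card_le (monotone_filter_right _ fun _ _ h => ⟨h.1, h.1⟩) (by omega)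
    have hmem : F ∈ ({F ∈ lineCliques G M | x ∈ F ∧ x ∈ F} : Finset _) := by simp [hF, hx]
    rw [← heq, mem_filter] at hmem
    exact hmem.2.2
  exact ⟨key x y hT, key y x (cliqueEntry_comm G M x y ▸ hT)⟩

theorem neg_three_le_lambdaMin [Nonempty V] (h : IsCliqueLocal G M) : -3 ≤ lambdaMin G := by
  apply neg_le_lambdaMin_of_shiftedForm_nonneg
  intro u
  -- `A + 3I` is `T` plus the Gram matrix of the family. In a row with an entry -1 the diagonal of
  -- `T` is 1; in every other row `T` is diagonal and nonnegative.
  set T : V → V → ℝ := fun x y => ((if G.Adj x y then 1 else 0) + if x = y then 3 else 0) -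
    #{F ∈ lineCliques G M | x ∈ F ∧ y ∈ F} with hTdef
  have hself : ∀ x, T x x = 3 - #{F ∈ lineCliques G M | x ∈ F ∧ x ∈ F} := fun x => by simp [hTdef]
  have hzero : ∀ x y, x ≠ y → cliqueEntry G M x y ≠ -1 → T x y = 0 := by
    intro x y hxy hne
    simp [hTdef, hxy, h.card_filter_lineCliques_eq_ite hxy hne]
  have hsq : ∑ x, ∑ y, u x * #{F ∈ lineCliques G M | x ∈ F ∧ y ∈ F} * u y =
      ∑ F ∈ lineCliques G M, (∑ x ∈ F, u x) ^ 2 := by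
    have hF : ∀ F : Finset V, (∑ x ∈ F, u x) ^ 2 =
        ∑ x, ∑ y, u x * (if x ∈ F ∧ y ∈ F then 1 else 0) * u y := by
      intro F
      have : ∑ x ∈ F, u x = ∑ x, u x * if x ∈ F then 1 else 0 := by simp
      rw [this, sq, sum_mul_sum]
      refine sum_congr rfl fun x _ => sum_congr rfl fun y _ => ?_
      rw [ite_and]
      split_ifs <;> ring
    simp only [hF]
    rw [sum_comm (s := lineCliques G M)]
    refine sum_congr rfl fun x _ => ?_
    rw [sum_comm (s := lineCliques G M)]
    refine sum_congr rfl fun y _ => ?_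
    rw [← sum_mul, ← mul_sum, sum_boole]
  have hsplit : shiftedForm G 3 u u = ∑ x, ∑ y, u x * T x y * u y +
      ∑ F ∈ lineCliques G M, (∑ x ∈ F, u x) ^ 2 := by
    rw [← hsq, shiftedForm_apply, ← sum_add_distrib]
    refine sum_congr rfl fun x _ => ?_
    rw [← sum_add_distrib]
    exact sum_congr rfl fun y _ => by simp only [hTdef]; ring
  rw [hsplit]
  refine add_nonneg (sum_sum_mul_mul_nonneg_of_diagonally_dominant T ?_ ?_ u)
    (sum_nonneg fun _ _ => sq_nonneg _)
  · intro x y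
    simp only [hTdef, G.adj_comm x y, eq_comm (a := x), and_comm (a := x ∈ _)]
  · intro x
    rw [hself]
    by_cases hx : ∃ y, cliqueEntry G M x y = -1
    · obtain ⟨y, hy⟩ := hx
      have hxy := h.ne_of_entry_eq_neg_one hy
      obtain ⟨h1, h2⟩ := h.card_filter_lineCliques_of_entry_eq_neg_one hy
      rw [sum_eq_single_of_mem (f := fun z => |T x z|) y (mem_erase.2 ⟨hxy.symm, mem_univ y⟩), h2]
      · have : T x y = -1 := by
          simp only [hTdef, h1, (h.of_entry_eq_neg_one hy).1, hxy, if_true, if_false]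
          norm_num
        rw [this]
        norm_num
      · intro z hz hzy
        have hz' := h.entry_eq_zero_of_entry_eq_neg_one hy (ne_of_mem_erase hz).symm hzy.symm
        rw [hzero x z (ne_of_mem_erase hz).symm (by omega), abs_zero]
    · have hsum : ∑ y ∈ univ.erase x, |T x y| = 0 := sum_eq_zero fun z hz => by
        rw [hzero x z (ne_of_mem_erase hz).symm fun h => hx ⟨z, h⟩, abs_zero]
      have : (#{F ∈ lineCliques G M | x ∈ F ∧ x ∈ F} : ℝ) ≤ 3 := by
        exact_mod_cast h.card_filter_lineCliques_self_le x
      rw [hsum]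
      linarith

end IsCliqueLocal
end

/-! ### Two large cliques through every vertex -/

section
open Finset
variable {V : Type*} [Fintype V] [DecidableEq V] {G : SimpleGraph V} [DecidableRel G.Adj]

omit [DecidableEq V] [DecidableRel G.Adj] in
theorem exists_maximal_isClique_card_max {S : Finset V} (hS : G.IsClique (S : Set V)) :
    ∃ C : Finset V, S ⊆ C ∧ Maximal G.IsClique (C : Set V) ∧
      ∀ D : Finset V, S ⊆ D → G.IsClique (D : Set V) → #D ≤ #C := by
  classical
  obtain ⟨C, hC, hmax⟩ := exists_max_image
    ({C | S ⊆ C ∧ G.IsClique (C : Set V)} : Finset (Finset V)) card ⟨S, by simp [hS]⟩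
  simp only [mem_filter, mem_univ, true_and] at hC hmax
  refine ⟨C, hC.1, ⟨hC.2, fun D hD hCD => ?_⟩, fun D h1 h2 => hmax D ⟨h1, h2⟩⟩
  have hCD' : C ⊆ D.toFinset := fun v hv => Set.mem_toFinset.2 (hCD hv)
  have heq := eq_of_subset_of_card_le hCD' (hmax _ ⟨hC.1.trans hCD', by simpa using hD⟩)
  rw [heq]
  simp

/-- The star with sixteen leaves is not an induced subgraph if `-7/2 ≤ lambdaMin G`. -/
theorem card_ne_sixteen_of_isIndepSet (hlam : -(7 / 2) ≤ lambdaMin G) {x : V} {T : Finset V}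
    (hTx : ∀ y ∈ T, G.Adj x y) (hT : G.IsIndepSet (T : Set V)) : #T ≠ 16 := by
  intro hcard
  -- The test vector is the eigenvector of the star with sixteen leaves for the eigenvalue -4.
  have h := shiftedForm_nonneg_of_neg_le_lambdaMin G (7 / 2) hlam
    ((4 : ℝ) • Pi.single x 1 - ∑ y ∈ T, Pi.single y 1)
  have hs : ∀ v w, shiftedForm G (7 / 2) (Pi.single v 1) (Pi.single w 1) =
      (if G.Adj v w then 1 else 0) + if v = w then 7 / 2 else 0 := by
    intro v w
    simp [shiftedForm, Matrix.one_apply]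
  have h1 : shiftedForm G (7 / 2) (Pi.single x 1) (∑ y ∈ T, Pi.single y 1) = 16 := by
    rw [map_sum, sum_congr rfl (g := fun _ => (1 : ℝ)) fun y hy => by
      simp [hs, hTx y hy, (hTx y hy).ne]]
    simp [hcard]
  have h2 : shiftedForm G (7 / 2) (∑ y ∈ T, Pi.single y 1) (∑ y ∈ T, Pi.single y 1) =
      16 * (7 / 2) := by
    rw [map_sum, sum_congr rfl (g := fun _ => (7 / 2 : ℝ)) fun y hy => ?_]
    · simp [hcard]
    · rw [shiftedForm_comm, map_sum, sum_eq_single y]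
      · simp [hs]
      · intro z hz hzy
        simp [hs, hzy.symm, hT hy hz hzy.symm]
      · exact fun h => absurd hy h
  rw [LinearMap.BilinForm.sub_left, LinearMap.BilinForm.sub_right, LinearMap.BilinForm.sub_right,
    LinearMap.BilinForm.smul_left, LinearMap.BilinForm.smul_left, LinearMap.BilinForm.smul_right,
    shiftedForm_comm G _ (∑ y ∈ T, Pi.single y 1) ((4 : ℝ) • Pi.single x 1),
    LinearMap.BilinForm.smul_left, hs, h1, h2] at h
  norm_num at h
end

open Finset in
/-- If every clique is much smaller than the degrees of its vertices, then every vertex lies in two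
large maximal cliques. -/
theorem exists_two_le_cliqueCodegree (M : ℕ) (hM : 0 < M) : ∃ K : ℕ, 0 < K ∧
    ∀ (V : Type u) [Fintype V] [DecidableEq V] (G : SimpleGraph V) [DecidableRel G.Adj],
      (∀ (C : Finset V) (hC : C.Nonempty), G.IsClique (C : Set V) →
        (C.card : ℤ) ≤ C.inf' hC (fun x => (G.degree x : ℤ)) - (K : ℤ)) →
      -(7 / 2) ≤ lambdaMin G → ∀ x, 2 ≤ cliqueCodegree G M x x := by
  obtain ⟨N, hN⟩ := exists_isClique_or_isIndepSet M 16
  refine ⟨N + 1, Nat.succ_pos _, fun V _ _ G _ hdeg hlam x => ?_⟩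
  -- `C` has the largest order among cliques through `x`, so it is large as soon as a second, large
  -- clique through `x` is found.
  obtain ⟨C, hxC, hC, hmax⟩ := exists_maximal_isClique_card_max (G := G) (S := {x}) (by simp)
  rw [singleton_subset_iff] at hxC
  have hCdeg : #C + (N + 1) ≤ G.degree x := by
    have h1 := hdeg C ⟨x, hxC⟩ hC.prop
    have h2 := inf'_le (fun x => (G.degree x : ℤ)) hxC
    omega
  have hR : N ≤ #(G.neighborFinset x \ C) := by
    have := le_card_sdiff C (G.neighborFinset x)
    rw [G.card_neighborFinset_eq_degree] at this
    omega
  rcases hN V G _ hR with ⟨S, hS, hcard, hcl⟩ | ⟨T, hT, hcard, hind⟩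
  · have hSadj : ∀ y ∈ S, G.Adj x y ∧ y ∉ C := fun y hy => by
      have := mem_sdiff.1 (hS hy)
      exact ⟨(G.mem_neighborFinset x y).1 this.1, this.2⟩
    have hcl' : G.IsClique ((insert x S : Finset V) : Set V) := by
      rw [coe_insert, SimpleGraph.isClique_insert]
      exact ⟨hcl, fun b hb _ => (hSadj b hb).1⟩
    obtain ⟨C', hSC', hC', -⟩ := exists_maximal_isClique_card_max hcl'
    have hxC' : x ∈ C' := hSC' (mem_insert_self x S)
    have hMC' : M ≤ #C' := hcard ▸ card_le_card ((subset_insert x S).trans hSC')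
    have hMC : M ≤ #C := hMC'.trans (hmax C' (by simpa using hxC') hC'.prop)
    have hne : C ≠ C' := by
      rintro rfl
      obtain ⟨y, hy⟩ : S.Nonempty := card_pos.1 (hcard ▸ hM)
      exact (hSadj y hy).2 (hSC' (mem_insert_of_mem hy))
    rw [← card_pair hne]
    refine card_le_card fun E hE => ?_
    rw [mem_insert, mem_singleton] at hE
    rcases hE with rfl | rfl
    · exact mem_filter.2 ⟨(mem_bigCliques G M).2 ⟨hC, hMC⟩, hxC, hxC⟩
    · exact mem_filter.2 ⟨(mem_bigCliques G M).2 ⟨hC', hMC'⟩, hxC', hxC'⟩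
  · refine absurd hcard (card_ne_sixteen_of_isIndepSet hlam (x := x) (fun y hy => ?_) hind)
    exact (G.mem_neighborFinset x y).1 (mem_sdiff.1 (hT hy)).1

/-! ### The extended Hoffman graph and its decomposition -/

namespace HoffmanGraph

theorem eq_slim_of_ne_fat {l : HoffmanLabel} (h : l ≠ HoffmanLabel.fat) :
    l = HoffmanLabel.slim := by
  cases l
  · exact absurd rfl h
  · rfl

/-- A Hoffman graph in which all pairs of vertices are adjacent, except for pairs of fat vertices,
is an induced Hoffman subgraph of `completeHoffman s t` if it is small enough. -/
theorem nonempty_inducedEmbedding_completeHoffman {U : Type u} [Finite U] (h : HoffmanGraph U)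
    {s t : ℕ} (hs : 0 < s) (hslim : h.slimSet.ncard ≤ s) (hfat : h.fatSet.ncard ≤ t)
    (hadj : ∀ x ∈ h.slimSet, ∀ y, x ≠ y → h.graph.Adj x y) :
    Nonempty (InducedEmbedding h (completeHoffman s t hs)) := by
  classical
  have := Fintype.ofFinite U
  obtain ⟨es⟩ : Nonempty (h.slimSet ↪ Fin s) := by
    apply Function.Embedding.nonempty_of_card_le
    rwa [Fintype.card_fin, ← Nat.card_eq_fintype_card, Nat.card_coe_set_eq]
  obtain ⟨ef⟩ : Nonempty (h.fatSet ↪ Fin t) := by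
    apply Function.Embedding.nonempty_of_card_le
    rwa [Fintype.card_fin, ← Nat.card_eq_fintype_card, Nat.card_coe_set_eq]
  set f : U → Fin s ⊕ Fin t := fun x =>
    if hx : h.label x = HoffmanLabel.fat then Sum.inr (ef ⟨x, hx⟩)
    else Sum.inl (es ⟨x, eq_slim_of_ne_fat hx⟩) with hf
  have hf1 : ∀ x (hx : h.label x = HoffmanLabel.fat), f x = Sum.inr (ef ⟨x, hx⟩) :=
    fun x hx => dif_pos hx
  have hf2 : ∀ x (hx : h.label x ≠ HoffmanLabel.fat),
      f x = Sum.inl (es ⟨x, eq_slim_of_ne_fat hx⟩) := fun x hx => dif_neg hx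
  have hinj : Function.Injective f := by
    intro x y hxy
    by_cases hx : h.label x = HoffmanLabel.fat <;> by_cases hy : h.label y = HoffmanLabel.fat
    · rw [hf1 x hx, hf1 y hy] at hxy
      exact congrArg Subtype.val (ef.injective (Sum.inr_injective hxy))
    · rw [hf1 x hx, hf2 y hy] at hxy
      cases hxy
    · rw [hf2 x hx, hf1 y hy] at hxy
      cases hxy
    · rw [hf2 x hx, hf2 y hy] at hxy
      exact congrArg Subtype.val (es.injective (Sum.inl_injective hxy))
  refine ⟨⟨⟨⟨f, hinj⟩, ?_⟩, ?_⟩⟩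
  · intro x y
    change (f x ≠ f y ∧ ¬ ((f x).isRight ∧ (f y).isRight)) ↔ h.graph.Adj x y
    rw [hinj.ne_iff]
    by_cases hx : h.label x = HoffmanLabel.fat <;> by_cases hy : h.label y = HoffmanLabel.fat
    · rw [hf1 x hx, hf1 y hy]
      simpa using h.not_adj_of_fat x y hx hy
    · have h1 : h.graph.Adj x y ↔ x ≠ y :=
        ⟨fun h => h.ne, fun hne => (hadj y (eq_slim_of_ne_fat hy) x hne.symm).symm⟩
      rw [h1, hf2 y hy]
      simp
    · have h1 : h.graph.Adj x y ↔ x ≠ y :=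
        ⟨fun h => h.ne, fun hne => hadj x (eq_slim_of_ne_fat hx) y hne⟩
      rw [h1, hf2 x hx]
      simp
    · have h1 : h.graph.Adj x y ↔ x ≠ y :=
        ⟨fun h => h.ne, fun hne => hadj x (eq_slim_of_ne_fat hx) y hne⟩
      rw [h1, hf2 x hx]
      simp
  · intro x
    change (completeHoffman s t hs).label (f x) = _
    by_cases hx : h.label x = HoffmanLabel.fat
    · rw [hf1 x hx, hx]
      rfl
    · rw [hf2 x hx]
      exact (eq_slim_of_ne_fat hx).symm

end HoffmanGraph

/-- The Hoffman graph with slim graph `G` whose fat vertices are the members of a family of sets,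
each of them adjacent to its own elements. -/
def familyHoffman {V : Type u} (G : SimpleGraph V) (𝓕 : Finset (Finset V))
    (hne : ∀ F ∈ 𝓕, F.Nonempty) : HoffmanGraph (V ⊕ {F : Finset V // F ∈ 𝓕}) where
  graph :=
    { Adj := fun a b =>
        match a, b with
        | Sum.inl x, Sum.inl y => G.Adj x y
        | Sum.inl x, Sum.inr F => x ∈ F.1
        | Sum.inr F, Sum.inl x => x ∈ F.1
        | Sum.inr _, Sum.inr _ => False
      symm := ⟨by
        rintro (x | C) (y | D) hxy
        · exact SimpleGraph.Adj.symm hxy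
        · exact hxy
        · exact hxy
        · exact hxy⟩
      loopless := ⟨by
        rintro (x | C) hx
        · exact G.irrefl hx
        · exact hx⟩ }
  label := Sum.elim (fun _ => HoffmanLabel.slim) (fun _ => HoffmanLabel.fat)
  not_adj_of_fat := by
    rintro (f | f) (g | g) hf hg hadj
    · cases hf
    · cases hf
    · cases hg
    · exact hadj
  exists_slim_adj := by
    rintro (f | ⟨F, hF⟩) hf
    · cases hf
    · obtain ⟨x, hx⟩ := hne F hF
      exact ⟨Sum.inl x, rfl, hx⟩

section
open Finset HoffmanGraph
variable {V : Type u} (G : SimpleGraph V) (𝓕 : Finset (Finset V)) (hne : ∀ F ∈ 𝓕, F.Nonempty)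

open Classical in
theorem specialMatrix_familyHoffman [Fintype V] (x y : V) :
    (familyHoffman G 𝓕 hne).specialMatrix ⟨Sum.inl x, rfl⟩ ⟨Sum.inl y, rfl⟩ =
      (if G.Adj x y then 1 else 0) - #{F ∈ 𝓕 | x ∈ F ∧ y ∈ F} := by
  simp only [specialMatrix, Matrix.sub_apply, Matrix.submatrix_apply, Matrix.mul_apply,
    Matrix.transpose_apply, SimpleGraph.adjMatrix_apply]
  congr 1
  have hcard : (#{F ∈ 𝓕 | x ∈ F ∧ y ∈ F} : ℝ) =
      ∑ F : {F : Finset V // F ∈ 𝓕}, (if x ∈ F.1 then 1 else 0) * (if y ∈ F.1 then 1 else 0) := by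
    rw [univ_eq_attach,
      sum_attach 𝓕 fun F => (if x ∈ F then (1 : ℝ) else 0) * (if y ∈ F then 1 else 0)]
    simp only [mul_ite, mul_one, mul_zero, ← ite_and, sum_boole, and_comm]
  rw [hcard]
  symm
  refine sum_of_injOn (fun F => (⟨Sum.inr F, rfl⟩ : (familyHoffman G 𝓕 hne).fatSet)) ?_ ?_ ?_ ?_
  · intro F _ F' _ h
    exact Sum.inr_injective (congrArg Subtype.val h)
  · intro F _
    simp
  · rintro ⟨z | F, hf⟩ _ hF
    · cases hf
    · exact absurd ⟨F, by simp, rfl⟩ hF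
  · intro F _
    exact congrArg₂ (· * ·) (if_congr Iff.rfl rfl rfl) (if_congr Iff.rfl rfl rfl)

end

namespace IsCliqueLocal
open Finset HoffmanGraph
variable {V : Type u} [Fintype V] [DecidableEq V] {G : SimpleGraph V} [DecidableRel G.Adj] {M : ℕ}

theorem nonempty_of_mem_lineCliques (hM : 0 < M) :
    ∀ F ∈ lineCliques G M, F.Nonempty := by
  intro F hF
  rw [lineCliques, mem_union, mem_image] at hF
  rcases hF with hF | ⟨x, -, rfl⟩
  · exact card_pos.1 (hM.trans_le ((mem_bigCliques G M).1 hF).2)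
  · exact ⟨x, mem_plusClass.2 (Or.inl rfl)⟩

variable (G M) in
/-- A vertex `x` together with the vertices `y` with `cliqueEntry G M x y = -1`. -/
noncomputable def minusBlock (x : V) : Finset V := {y | y = x ∨ cliqueEntry G M x y = -1}

theorem mem_minusBlock {x y : V} : y ∈ minusBlock G M x ↔ y = x ∨ cliqueEntry G M x y = -1 := by
  simp [minusBlock]

theorem self_mem_minusBlock (x : V) : x ∈ minusBlock G M x := mem_minusBlock.2 (Or.inl rfl)

theorem minusBlock_eq_pair (h : IsCliqueLocal G M) {x y : V} (hT : cliqueEntry G M x y = -1) :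
    minusBlock G M x = {x, y} := by
  ext z
  rw [mem_minusBlock, mem_insert, mem_singleton]
  refine or_congr_right ⟨fun hz => ?_, fun hz => hz ▸ hT⟩
  by_contra hzy
  have := h.entry_eq_zero_of_entry_eq_neg_one hT (h.ne_of_entry_eq_neg_one hz) (Ne.symm hzy)
  omega

theorem minusBlock_eq_of_mem (h : IsCliqueLocal G M) {x y : V} (hy : y ∈ minusBlock G M x) :
    minusBlock G M y = minusBlock G M x := by
  rw [mem_minusBlock] at hy
  rcases hy with rfl | hy
  · rfl
  · rw [h.minusBlock_eq_pair hy, h.minusBlock_eq_pair (cliqueEntry_comm G M x y ▸ hy), pair_comm]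

theorem isDecomposition_minusBlock (h : IsCliqueLocal G M) (hM : 0 < M) {r : ℕ}
    (e : Fin r ≃ {B // B ∈ univ.image (minusBlock G M)}) :
    (familyHoffman G (lineCliques G M) (nonempty_of_mem_lineCliques hM)).IsDecomposition
      fun i => Sum.inl '' ((e i).1 : Set V) := by
  have hB : ∀ i, ∃ x, minusBlock G M x = (e i).1 := fun i => by
    obtain ⟨x, -, hx⟩ := mem_image.1 (e i).2
    exact ⟨x, hx⟩
  have hBx : ∀ i, ∀ x ∈ (e i).1, (e i).1 = minusBlock G M x := by
    intro i x hx
    obtain ⟨z, hz⟩ := hB i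
    rw [← hz] at hx ⊢
    exact (h.minusBlock_eq_of_mem hx).symm
  constructor
  · intro i
    obtain ⟨x, hx⟩ := hB i
    exact ⟨Sum.inl x, x, hx ▸ self_mem_minusBlock x, rfl⟩
  · intro i j hij
    rw [Set.disjoint_left]
    rintro _ ⟨x, hx, rfl⟩ ⟨y, hy, hxy⟩
    obtain rfl := Sum.inl_injective hxy
    exact hij (e.injective (Subtype.ext ((hBx i _ hx).trans (hBx j _ hy).symm)))
  · ext w
    rw [Set.mem_iUnion]
    constructor
    · rintro ⟨i, x, -, rfl⟩
      rfl
    · intro hw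
      rcases w with x | F
      · refine ⟨e.symm ⟨minusBlock G M x, mem_image_of_mem _ (mem_univ x)⟩, x, ?_, rfl⟩
        rw [Equiv.apply_symm_apply]
        exact self_mem_minusBlock x
      · cases hw
  · rintro i j hij ⟨_, hx'⟩ ⟨_, hy'⟩ ⟨x, hx, rfl⟩ ⟨y, hy, rfl⟩
    have hne : y ∉ minusBlock G M x := by
      intro hyx
      refine hij (e.injective (Subtype.ext ?_))
      rw [hBx i x hx, hBx j y hy, h.minusBlock_eq_of_mem hyx]
    rw [mem_minusBlock, not_or] at hne
    have := specialMatrix_familyHoffman G (lineCliques G M) (nonempty_of_mem_lineCliques hM) x y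
    refine this.trans ?_
    have hc := h.card_filter_lineCliques_eq_ite (Ne.symm hne.1) hne.2
    rw [sub_eq_zero]
    symm
    convert congrArg (Nat.cast : ℕ → ℝ) hc
    push_cast
    congr

/-- The vertices of a block are mutually adjacent and lie in the same members of the family, so only
the numbers of slim and fat vertices matter. -/
theorem nonempty_inducedEmbedding_generated_minusBlock (h : IsCliqueLocal G M) (hM : 0 < M) (x : V)
    {s t : ℕ} (hs : 0 < s) (hcard : #(minusBlock G M x) ≤ s)
    (hfat : #{F ∈ lineCliques G M | x ∈ F ∧ x ∈ F} ≤ t) :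
    Nonempty (InducedEmbedding
      ((familyHoffman G (lineCliques G M) (nonempty_of_mem_lineCliques hM)).generated
        (Sum.inl '' (minusBlock G M x : Set V))) (completeHoffman s t hs)) := by
  set k := familyHoffman G (lineCliques G M) (nonempty_of_mem_lineCliques hM)
  have hmem : ∀ v ∈ minusBlock G M x, ∀ F ∈ lineCliques G M, v ∈ F ↔ x ∈ F := by
    intro v hv F hF
    rw [mem_minusBlock] at hv
    rcases hv with rfl | hv
    · rfl
    · exact (h.mem_lineCliques_iff_of_entry_eq_neg_one hv hF).symm
  have hadj : ∀ v ∈ minusBlock G M x, ∀ w ∈ minusBlock G M x, v ≠ w → G.Adj v w := by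
    intro v hv w hw hvw
    rw [← h.minusBlock_eq_of_mem hv, mem_minusBlock] at hw
    exact (h.of_entry_eq_neg_one (hw.resolve_left hvw.symm)).1
  have hinl : ∀ v, Sum.inl v ∈ k.generatedSet (Sum.inl '' (minusBlock G M x : Set V)) →
      v ∈ minusBlock G M x := by
    rintro v (⟨⟨w, hw, hwv⟩, -⟩ | ⟨hv, -⟩)
    · exact Sum.inl_injective hwv ▸ hw
    · cases hv
  have hinr : ∀ F : {F // F ∈ lineCliques G M},
      Sum.inr F ∈ k.generatedSet (Sum.inl '' (minusBlock G M x : Set V)) → x ∈ F.1 := by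
    rintro F (⟨-, hF⟩ | ⟨-, _, ⟨v, hv, rfl⟩, -, hvF⟩)
    · cases hF
    · exact (hmem v hv F.1 F.2).1 hvF
  apply nonempty_inducedEmbedding_completeHoffman
  · refine le_trans ?_ hcard
    rw [← Set.ncard_image_of_injective _ Subtype.val_injective, ← Set.ncard_coe_finset,
      ← Set.ncard_image_of_injective (minusBlock G M x : Set V)
        (Sum.inl_injective (β := {F // F ∈ lineCliques G M}))]
    refine Set.ncard_le_ncard ?_ (Set.toFinite _)
    rintro _ ⟨⟨v | F, hw⟩, hl, rfl⟩
    · exact ⟨v, hinl v hw, rfl⟩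
    · cases hl
  · refine le_trans ?_ hfat
    rw [← Set.ncard_image_of_injective _ Subtype.val_injective, ← Set.ncard_coe_finset]
    -- The value `∅` on slim vertices is a dummy: only fat vertices are counted.
    refine Set.ncard_le_ncard_of_injOn (fun w => Sum.elim (fun _ => ∅) Subtype.val w) ?_ ?_
      (Set.toFinite _)
    · rintro _ ⟨⟨v | F, hw⟩, hl, rfl⟩
      · cases hl
      · exact mem_coe.2 (mem_filter.2 ⟨F.2, hinr F hw, hinr F hw⟩)
    · rintro _ ⟨⟨v | F, hw⟩, hl, rfl⟩ _ ⟨⟨v' | F', hw'⟩, hl', rfl⟩ heq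
      · cases hl
      · cases hl
      · cases hl'
      · exact congrArg Sum.inr (Subtype.ext heq)
  · rintro ⟨v | F, hw⟩ hl ⟨v' | F', hw'⟩ hne
    · exact hadj v (hinl v hw) v' (hinl v' hw') fun h => hne (by subst h; rfl)
    · exact (hmem v (hinl v hw) F'.1 F'.2).2 (hinr F' hw')
    · cases hl
    · cases hl

theorem isFat_associatedHoffman (h : IsCliqueLocal G M) {q : ℕ} (hq2 : 2 ≤ q) (hqM : q ≤ M) :
    (associatedHoffman G q hq2).IsFat 2 := by
  rintro (x | C) hx
  · obtain ⟨F, hF, F', hF', hne⟩ := one_lt_card.1 (h.two_le x)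
    rw [mem_filter, mem_bigCliques] at hF hF'
    refine Set.one_lt_ncard_iff (Set.toFinite _) |>.2 ⟨
      Sum.inr ⟨F, hF.1.1, by rw [Set.ncard_coe_finset]; omega⟩,
      Sum.inr ⟨F', hF'.1.1, by rw [Set.ncard_coe_finset]; omega⟩,
      ⟨rfl, hF.2.1⟩, ⟨rfl, hF'.2.1⟩, fun heq => hne ?_⟩
    exact coe_injective (congrArg Subtype.val (Sum.inr_injective heq))
  · cases hx

theorem isLine_associatedHoffman (h : IsCliqueLocal G M) {q : ℕ} (hq2 : 2 ≤ q) (hq : 42 < q)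
    (hM : 0 < M) : (associatedHoffman G q hq2).IsLine lineFamily := by
  classical
  have hline : ∀ C : {C : Set V // Maximal G.IsClique C ∧ q ≤ C.ncard},
      C.1.toFinset ∈ lineCliques G M := by
    rintro ⟨C, hC, hqC⟩
    obtain ⟨F, rfl⟩ : ∃ F : Finset V, (F : Set V) = C := ⟨C.toFinset, by simp⟩
    rw [Set.ncard_coe_finset] at hqC
    simp only [toFinset_coe]
    rw [lineCliques, mem_union]
    -- A fat vertex of the associated Hoffman graph is either a large clique or, being of medium
    -- size, a nontrivial plus class.
    by_cases hMF : M ≤ #F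
    · exact Or.inl ((mem_bigCliques G M).2 ⟨hC, hMF⟩)
    · obtain ⟨x, hx, y, hy, hxy⟩ := one_lt_card.1 (show 1 < #F by omega)
      have heq := h.eq_plusClass hC (by omega) (by omega) hx
      refine Or.inr (mem_image.2 ⟨x, mem_filter.2 ⟨mem_univ x, y, ?_⟩, heq.symm⟩)
      rw [heq, mem_plusClass] at hy
      exact hy.resolve_left hxy.symm
  refine ⟨_, inferInstance, familyHoffman G (lineCliques G M) (nonempty_of_mem_lineCliques hM),
    ⟨⟨⟨⟨Sum.map id fun C => ⟨C.1.toFinset, hline C⟩, ?_⟩, ?_⟩, ?_⟩, ?_⟩, _, _,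
    h.isDecomposition_minusBlock hM (univ.image (minusBlock G M)).equivFin.symm, ?_⟩
  · refine Sum.map_injective.2 ⟨Function.injective_id, fun C C' hCC => Subtype.ext ?_⟩
    exact Set.toFinset_inj.1 (congrArg Subtype.val hCC)
  · rintro (x | C) (y | D)
    · rfl
    · exact Set.mem_toFinset
    · exact Set.mem_toFinset
    · rfl
  · rintro (x | C) <;> rfl
  · rintro (x | C) hw
    · exact ⟨Sum.inl x, rfl, rfl⟩
    · cases hw
  · intro i
    obtain ⟨x, -, hB⟩ := mem_image.1 ((univ.image (minusBlock G M)).equivFin.symm i).2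
    rw [← hB]
    by_cases hx : ∃ y, cliqueEntry G M x y = -1
    · obtain ⟨y, hy⟩ := hx
      refine ⟨_, Or.inr rfl, h.nonempty_inducedEmbedding_generated_minusBlock hM x (by decide) ?_
        (h.card_filter_lineCliques_of_entry_eq_neg_one hy).2.le⟩
      rw [h.minusBlock_eq_pair hy]
      exact card_le_two
    · refine ⟨_, Or.inl rfl, h.nonempty_inducedEmbedding_generated_minusBlock hM x (by decide) ?_
        (h.card_filter_lineCliques_self_le x)⟩
      rw [card_le_one]
      intro a ha b hb
      rw [mem_minusBlock] at ha hb
      rw [ha.resolve_right fun h => hx ⟨a, h⟩, hb.resolve_right fun h => hx ⟨b, h⟩]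

end IsCliqueLocal

/-! ### Choice of the constants -/

theorem theorem4p3 (c : ℕ) (hc : 0 < c) (ε : ℝ) (hε : 0 < ε) (q : ℕ) (hq2 : 2 ≤ q)
    (hq : max (c + 5) (50 * min c 6 + 16) ≤ q) :
    ∃ K : ℕ, 0 < K ∧
      ∀ (V : Type u) [Fintype V] [Nonempty V] (G : SimpleGraph V) [DecidableRel G.Adj],
        IsMuBounded G c →
        (∀ (C : Finset V) (hC : C.Nonempty), G.IsClique (C : Set V) →
          (C.card : ℤ) ≤ C.inf' hC (fun x => (G.degree x : ℤ)) - (K : ℤ)) →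
        -2 - Real.sqrt 2 + ε ≤ lambdaMin G →
        (associatedHoffman G q hq2).IsFat 2 ∧
          (associatedHoffman G q hq2).IsLine HoffmanGraph.lineFamily ∧
          -3 ≤ lambdaMin G := by
  -- As `c` is at least 1, the second term of the maximum is at least 66.
  have hq42 : 42 < q := by omega
  -- Replacing `ε` by a smaller `δ` weakens the eigenvalue hypothesis and keeps `θ = 2 + √2 - δ`
  -- above 1.
  obtain ⟨δ, hδ, hδ', hδε⟩ : ∃ δ : ℝ, 0 < δ ∧ δ ≤ 1 / 10 ∧ δ ≤ ε :=
    ⟨min ε (1 / 10), by positivity, min_le_right _ _, min_le_left _ _⟩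
  -- `q ≤ M` makes large cliques fat vertices of the associated Hoffman graph; the other bound keeps
  -- the Bessel error below `δ`.
  obtain ⟨M, hM⟩ := exists_nat_ge (max (q : ℝ) ((2 * c + 4) * 2475 / δ))
  have hqM : q ≤ M := by exact_mod_cast (le_max_left _ _).trans hM
  have hM0 : 0 < M := by omega
  have herr : (2 * c + 4) / (M : ℝ) * 2475 ≤ δ := by
    have h1 := (le_max_right _ _).trans hM
    rw [div_le_iff₀ hδ] at h1
    rw [div_mul_eq_mul_div, div_le_iff₀ (by exact_mod_cast hM0)]
    linarith
  obtain ⟨K, hK, hKM⟩ := exists_two_le_cliqueCodegree M hM0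
  refine ⟨K, hK, fun V _ _ G _ hmu hdeg hlam => ?_⟩
  classical
  have hs : √2 ≤ 3 / 2 := by
    rw [Real.sqrt_le_left (by norm_num)]
    norm_num
  have hloc : IsCliqueLocal G M := isCliqueLocal_of_lambdaMin hmu hM0 hδ hδ' (by linarith) herr
    (hKM V G hdeg (by linarith))
  exact ⟨hloc.isFat_associatedHoffman hq2 hqM, hloc.isLine_associatedHoffman hq2 hq42 hM0,
    hloc.neg_three_le_lambdaMin⟩
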